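/- Let $\Lambda\subset\mathbb C$ be a lattice with Weierstrass functions $\sigma$ and $\wp$, and set $$F(x,y;\alpha)=\frac{\sigma(x+y+\alpha)\,\sigma(x-y+\alpha)}{\sigma(x+y-\alpha)\,\sigma(x-y-\alpha)},\qquad f(x,y;\alpha)=\tfrac12\log F(x,y;\alpha),$$ where $f$ is multivalued (defined modulo $\pi i$). Let $\varepsilon\in\mathbb C$ and $(\beta_k)_{k\in\mathbb Z}\subset\mathbb C$ be parameters. One time step $(x_k,p_k)_{k\in\mathbb Z}\mapsto(\widetilde x_k,\widetilde p_k)_{k\in\mathbb Z}$ of the discrete elliptic Toda system on the triangular lattice, in Hamiltonian form, is given by the equations $$p_k=-f(x_k,\widetilde x_k;\varepsilon)+f(x_k,x_{k+1};\beta_k)+f(x_k,x_{k-1};\beta_{k-1})-f(x_k,\widetilde x_{k-1};\beta_{k-1}-\varepsilon),$$ $$\widetilde p_k=f(\widetilde x_k,x_k;\varepsilon)+f(\widetilde x_k,x_{k+1};\beta_k-\varepsilon)$$ for all $k\in\mathbb Z$, where each $f$ stands for one of its values. Put $$M(x,\beta;\lambda)=\frac{\sigma^2(x+\lambda-\beta)\,\sigma^2(x-\lambda)}{\sigma(2x)\,\sigma(2\lambda)}\begin{pmatrix}-\wp(x+\lambda-\beta)&\wp(x+\lambda-\beta)\wp(x-\lambda)\\-1&\wp(x-\lambda)\end{pmatrix},$$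 $$L_k=e^{p_k}M(x_k,\beta_k;\lambda)+e^{-p_k}M(x_k,-\beta_k;-\lambda),\qquad \widetilde L_k=e^{\widetilde p_k}M(\widetilde x_k,\beta_k;\lambda)+e^{-\widetilde p_k}M(\widetilde x_k,-\beta_k;-\lambda),$$ $$V_k=e^{\varepsilon G_k}M(x_k,\varepsilon;\lambda)+e^{-\varepsilon G_k}M(x_k,-\varepsilon;-\lambda),\qquad \varepsilon G_k=f(x_k,x_{k-1};\beta_{k-1})-f(x_k,\widetilde x_{k-1};\beta_{k-1}-\varepsilon),$$ where $\varepsilon G_k$ denotes a choice of a value of the right-hand side (so $V_k$ is defined up to a sign). Assume that for all $k$ one has $2x_k,2\widetilde x_k\notin\Lambda$ and that $f(x_k,\widetilde x_k;\varepsilon)$, $f(x_k,x_{k+1};\beta_k)$, $f(\widetilde x_k,x_{k+1};\beta_k-\varepsilon)$ are defined, i.e. the arguments of all $\sigma$'s in the corresponding $F$'s are not in $\Lambda$. Call $\lambda\in\mathbb C$ admissible at $k$ if all the matrices $\widetilde L_k,V_k,V_{k+1},L_k$ are defined at $\lambda$ (no vanishing denominator and no pole of $\wp$). Then the system has the zero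 curvature representation $\widetilde L_kV_k=V_{k+1}L_k$ with spectral parameter $\lambda$, in the following sense. (1) If the equations of the system hold, then the values of $\varepsilon G_k$ can be chosen, independently of $\lambda$, such that $$\widetilde L_kV_k=V_{k+1}L_k\qquad\text{for all }k\in\mathbb Z\text{ and all }\lambda\text{ admissible at }k.$$ Moreover, for every choice of the values of $\varepsilon G_k$ and every $k$, one has $\widetilde L_kV_k=s_kV_{k+1}L_k$ for all $\lambda$ admissible at $k$, with a sign $s_k\in\{1,-1\}$ that does not depend on $\lambda$. (2) Conversely, suppose that $2\varepsilon\notin\Lambda$ and $2(\beta_k-\varepsilon)\notin\Lambda$ for all $k$. If, for some choice of the values of $\varepsilon G_k$ and for every $k$, one has $\widetilde L_kV_k=s_kV_{k+1}L_k$ for all $\lambda$ admissible at $k$ with a sign $s_k\in\{1,-1\}$ independent of $\lambda$, then the equations of the system hold. -/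

import Mathlib

open scoped Pointwise

namespace EllipticToda

noncomputable section

/-- The Weierstrass `σ`-function of the period lattice of `Ω`,
`σ(z) = z ∏_{l ≠ 0} (1 - z / l) exp (z / l + z² / (2 l²))`.
The factor at `l = 0` equals `1` because of the convention `z / 0 = 0`. -/
def sigma (Ω : PeriodPair) (z : ℂ) : ℂ :=
  z * ∏' l : Ω.lattice, (1 - z / (l : ℂ)) * Complex.exp (z / (l : ℂ) + z ^ 2 / (2 * (l : ℂ) ^ 2))

/-- `F(x, y; α) = σ(x+y+α) σ(x-y+α) / (σ(x+y-α) σ(x-y-α))`. -/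
def legF (Ω : PeriodPair) (x y α : ℂ) : ℂ :=
  (sigma Ω (x + y + α) * sigma Ω (x - y + α)) / (sigma Ω (x + y - α) * sigma Ω (x - y - α))

/-- The four arguments of `σ` in `F(x, y; α)` avoid the zeros of `σ`, so that
`f(x, y; α) = (1/2) log F(x, y; α)` is defined. -/
def LegDefined (Ω : PeriodPair) (x y α : ℂ) : Prop :=
  x + y + α ∉ Ω.lattice ∧ x - y + α ∉ Ω.lattice ∧ x + y - α ∉ Ω.lattice ∧ x - y - α ∉ Ω.lattice

/-- The multivalued function `f(x, y; α) = (1/2) log F(x, y; α)`: the set of all its values. -/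
def legf (Ω : PeriodPair) (x y α : ℂ) : Set ℂ :=
  {w | Complex.exp (2 * w) = legF Ω x y α}

/-- The matrix `M(x, β; λ)`. -/
def matM (Ω : PeriodPair) (x β lam : ℂ) : Matrix (Fin 2) (Fin 2) ℂ :=
  ((sigma Ω (x + lam - β) ^ 2 * sigma Ω (x - lam) ^ 2) / (sigma Ω (2 * x) * sigma Ω (2 * lam))) •
    !![-Ω.weierstrassP (x + lam - β), Ω.weierstrassP (x + lam - β) * Ω.weierstrassP (x - lam);
       -1, Ω.weierstrassP (x - lam)]

/-- The denominators in `M(x, β; λ)` do not vanish and the values of `℘` in it are finite. -/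
def MatDefined (Ω : PeriodPair) (x β lam : ℂ) : Prop :=
  2 * x ∉ Ω.lattice ∧ 2 * lam ∉ Ω.lattice ∧ x + lam - β ∉ Ω.lattice ∧ x - lam ∉ Ω.lattice

/-- `L(x, p, β; λ) = e^p M(x, β; λ) + e^{-p} M(x, -β; -λ)`. -/
def matL (Ω : PeriodPair) (x p β lam : ℂ) : Matrix (Fin 2) (Fin 2) ℂ :=
  Complex.exp p • matM Ω x β lam + Complex.exp (-p) • matM Ω x (-β) (-lam)

/-- `V = e^g M(x, ε; λ) + e^{-g} M(x, -ε; -λ)`, where `g` is the value of `εG`. -/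
def matV (Ω : PeriodPair) (x g ε lam : ℂ) : Matrix (Fin 2) (Fin 2) ℂ :=
  Complex.exp g • matM Ω x ε lam + Complex.exp (-g) • matM Ω x (-ε) (-lam)

/-- Both summands `M(x, β; λ)` and `M(x, -β; -λ)` are defined. -/
def PairDefined (Ω : PeriodPair) (x β lam : ℂ) : Prop :=
  MatDefined Ω x β lam ∧ MatDefined Ω x (-β) (-lam)

/-- One time step `(x, p) ↦ (xt, pt)` of the discrete elliptic Toda system on the triangular
lattice, in Hamiltonian form. Each occurrence of `f` stands for any of its values. -/
structure IsTodaStep (Ω : PeriodPair) (ε : ℂ) (β x p xt pt : ℤ → ℂ) : Prop where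
  eq_p : ∀ k, p k ∈
    -legf Ω (x k) (xt k) ε + legf Ω (x k) (x (k + 1)) (β k)
      + legf Ω (x k) (x (k - 1)) (β (k - 1)) - legf Ω (x k) (xt (k - 1)) (β (k - 1) - ε)
  eq_pt : ∀ k, pt k ∈ legf Ω (xt k) (x k) ε + legf Ω (xt k) (x (k + 1)) (β k - ε)

/-- The values of `εG = f(x, x₋₁; β₋₁) - f(x, xt₋₁; β₋₁ - ε)` at the site `k`. -/
def epsG (Ω : PeriodPair) (ε : ℂ) (β x xt : ℤ → ℂ) (k : ℤ) : Set ℂ :=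
  legf Ω (x k) (x (k - 1)) (β (k - 1)) - legf Ω (x k) (xt (k - 1)) (β (k - 1) - ε)

/-- All fields are generic: `2x, 2xt ∉` lattice, and `f` is defined on all edges of the
triangular lattice between the two time levels. -/
structure Generic (Ω : PeriodPair) (ε : ℂ) (β x xt : ℤ → ℂ) : Prop where
  two_x : ∀ k, 2 * x k ∉ Ω.lattice
  two_xt : ∀ k, 2 * xt k ∉ Ω.lattice
  vert : ∀ k, LegDefined Ω (x k) (xt k) ε
  horiz : ∀ k, LegDefined Ω (x k) (x (k + 1)) (β k)
  diag : ∀ k, LegDefined Ω (xt k) (x (k + 1)) (β k - ε)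

/-- The spectral parameter `λ` is admissible at the site `k`: the matrices
`L(xt, pt, β; λ)`, `V`, `V₁`, `L(x, p, β; λ)` are all defined. -/
def Admissible (Ω : PeriodPair) (ε : ℂ) (β x xt : ℤ → ℂ) (k : ℤ) (lam : ℂ) : Prop :=
  PairDefined Ω (xt k) (β k) lam ∧ PairDefined Ω (x k) ε lam ∧
    PairDefined Ω (x (k + 1)) ε lam ∧ PairDefined Ω (x k) (β k) lam

/-- The zero curvature equation `Lt V = c V₁ L` at the site `k`, for all spectral parameters,
with a constant `c`. -/
def ZeroCurvature (Ω : PeriodPair) (ε : ℂ) (β x p xt pt g : ℤ → ℂ) (c : ℂ) (k : ℤ) : Prop :=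
  ∀ lam : ℂ, Admissible Ω ε β x xt k lam →
    matL Ω (xt k) (pt k) (β k) lam * matV Ω (x k) (g k) ε lam =
      c • (matV Ω (x (k + 1)) (g (k + 1)) ε lam * matL Ω (x k) (p k) (β k) lam)

end

end EllipticToda

/-!
The matrices act simply on the vectors `ψ(z) = σ(z)² (℘(z), 1)`. The addition formula
`σ(u+v) σ(u-v) = -σ(u)² σ(v)² (℘(u) - ℘(v))` says that `det (ψ(b), ψ(c)) = -σ(b+c) σ(b-c)`, and
`M(x, β; λ)` has rank one, being a multiple of `ψ(x+λ-β) ⊗ ψ(x-λ)^⊥`. Consequently `L(x, p, β; λ)`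
maps `ψ(x+λ)` to `e^p ψ(x+λ-β)` and `ψ(x-λ)` to `e^{-p} ψ(x-λ+β)` (`matL_mulVec_psi`).

To compare `L̃ V` with `V₁ L`, apply both to `ψ(x+λ)` and take determinants with `ψ(x̃+λ-β)`. On the
left one term survives. On the right there are two, which the equation for `e^{2 g₁}` and
Weierstrass's three-term identity (`sigma_four_product`) combine into one with the same dependence
on `λ`. What remains is a relation without `λ`, `CellRel`. The determinant with `ψ(x̃-λ+β)` gives
the same relation with `(x̃, p̃)` replaced by `(-x̃, -p̃)`, because `L(-x̃, -p̃, β; λ)` is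
`L(x̃, p̃, β; λ)`, and the vector `ψ(x-λ)` gives the same two relations again. Hence zero curvature
at a site, up to a sign `c`, is equivalent to two scalar relations
(`forall_matrix_eq_iff_cellRel`); their quotient and their product are the squared equations of
motion for `e^p̃` and `e^p`, and the sign `c` is what squaring loses (`exists_cellRel_iff`). The
signs of all sites are removed by a choice of the signs of the `V_k` along `ℤ`.

The facts about `σ` come from its product: the product converges locally uniformly together with
its derivatives, so `(log σ)'' = -℘`; periodicity of `℘` gives the quasi-periodicity of `σ`
(`exists_sigma_add_eq`). Then `σ(u+v) σ(u-v) / (σ(u)² σ(v)²) + ℘(u)` is an entire elliptic function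
of `u`, hence constant by Liouville's theorem, which is the addition formula
(`sigma_add_mul_sigma_sub`). The three-term identity is a formal consequence.
-/

namespace EllipticToda

open Filter Topology Complex

/-! ### The product defining `σ` -/

section

/-- The Weierstrass primary factor `E₂(w) = (1 - w) exp (w + w² / 2)` is `1 + O(w³)`. -/
lemma norm_primaryFactor_sub_one_le {w : ℂ} (hw : ‖w‖ ≤ 1) :
    ‖(1 - w) * exp (w + w ^ 2 / 2) - 1‖ ≤ Real.exp 2 * ‖w‖ ^ 3 := by
  have hd (t : ℂ) : HasDerivAt (fun t : ℂ ↦ (1 - t) * exp (t + t ^ 2 / 2))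
      (-t ^ 2 * exp (t + t ^ 2 / 2)) t := by
    have h1 : HasDerivAt (fun t : ℂ ↦ t + t ^ 2 / 2) (1 + t) t :=
      ((hasDerivAt_id t).add ((hasDerivAt_pow 2 t).div_const 2)).congr_deriv (by simp)
    refine (((hasDerivAt_id t).const_sub 1).mul h1.cexp).congr_deriv ?_
    simp only [id]; ring
  have hb : ∀ t ∈ Metric.closedBall (0 : ℂ) ‖w‖,
      ‖-t ^ 2 * exp (t + t ^ 2 / 2)‖ ≤ Real.exp 2 * ‖w‖ ^ 2 := by
    intro t ht
    have ht : ‖t‖ ≤ ‖w‖ := by simpa using ht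
    have h2 : ‖exp (t + t ^ 2 / 2)‖ ≤ Real.exp 2 := by
      rw [norm_exp]
      refine Real.exp_le_exp.mpr ((re_le_norm _).trans ((norm_add_le _ _).trans ?_))
      rw [norm_div, norm_pow, norm_ofNat]
      nlinarith [norm_nonneg t]
    rw [norm_mul, norm_neg, norm_pow, mul_comm]
    gcongr
  have := (convex_closedBall (0 : ℂ) ‖w‖).norm_image_sub_le_of_norm_hasDerivWithin_le
    (fun t _ ↦ (hd t).hasDerivWithinAt) hb (x := 0) (y := w) (by simp) (by simp)
  simp at this
  calc _ ≤ _ := this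
    _ = _ := by ring

variable (Ω : PeriodPair)

/-- The factor of `σ` at the lattice point `l`. -/
noncomputable def sigmaFactor (l : Ω.lattice) (z : ℂ) : ℂ :=
  (1 - z / (l : ℂ)) * exp (z / (l : ℂ) + z ^ 2 / (2 * (l : ℂ) ^ 2))

/-- The product of all factors of `σ` other than `z`, so that `σ(z) = z · sigmaProd z`. -/
noncomputable def sigmaProd (z : ℂ) : ℂ := ∏' l : Ω.lattice, sigmaFactor Ω l z

lemma sigma_eq_mul_sigmaProd (z : ℂ) : sigma Ω z = z * sigmaProd Ω z := rfl

lemma sigmaFactor_eq (l : Ω.lattice) (z : ℂ) :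
    sigmaFactor Ω l z = (1 - z / l) * exp (z / l + (z / l) ^ 2 / 2) := by
  rw [sigmaFactor]; congr 3; rw [div_pow, div_div, mul_comm]

lemma sigmaFactor_zero (z : ℂ) : sigmaFactor Ω 0 z = 1 := by simp [sigmaFactor]

lemma sigmaFactor_ne_zero {l : Ω.lattice} {z : ℂ} (hz : z ∉ Ω.lattice ∨ z = 0) :
    sigmaFactor Ω l z ≠ 0 := by
  by_cases hl : l = 0
  · subst hl; simp [sigmaFactor]
  have hl' : (l : ℂ) ≠ 0 := by simpa using hl
  refine mul_ne_zero ?_ (exp_ne_zero _)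
  rw [sub_ne_zero, ne_comm, Ne, div_eq_one_iff_eq hl']
  rintro rfl
  rcases hz with hz | hz
  · exact hz l.2
  · exact hl' hz

lemma differentiable_sigmaFactor (l : Ω.lattice) : Differentiable ℂ (sigmaFactor Ω l) := by
  unfold sigmaFactor
  fun_prop

lemma norm_sigmaFactor_sub_one_le {l : Ω.lattice} {z : ℂ} {r : ℝ} (hz : ‖z‖ ≤ r)
    (hl : r ≤ ‖(l : ℂ)‖) :
    ‖sigmaFactor Ω l z - 1‖ ≤ Real.exp 2 * r ^ 3 * ‖l‖ ^ (-3 : ℝ) := by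
  have h0 : ‖z / l‖ ≤ r / ‖(l : ℂ)‖ := by
    rw [norm_div]; gcongr
  rw [sigmaFactor_eq]
  refine (norm_primaryFactor_sub_one_le (h0.trans (div_le_one_of_le₀ hl (norm_nonneg _)))).trans ?_
  calc Real.exp 2 * ‖z / l‖ ^ 3 ≤ Real.exp 2 * (r / ‖(l : ℂ)‖) ^ 3 := by gcongr
    _ = Real.exp 2 * r ^ 3 * ‖l‖ ^ (-3 : ℝ) := by
      rw [Real.rpow_neg (norm_nonneg _), div_pow]
      norm_cast
      field

lemma summable_sigmaFactor_bound (r : ℝ) :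
    Summable fun l : Ω.lattice ↦ Real.exp 2 * r ^ 3 * ‖l‖ ^ (-3 : ℝ) :=
  (ZLattice.summable_norm_rpow _ _ (by simp; norm_num)).mul_left _

lemma eventually_norm_sigmaFactor_sub_one_le (r : ℝ) :
    ∀ᶠ l : Ω.lattice in cofinite, ∀ z ∈ Metric.ball (0 : ℂ) r,
      ‖sigmaFactor Ω l z - 1‖ ≤ Real.exp 2 * r ^ 3 * ‖l‖ ^ (-3 : ℝ) := by
  refine (isCompact_iff_finite.mp (isCompact_closedBall (0 : Ω.lattice) r)).subset ?_
  intro l hl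
  rw [mem_closedBall_zero_iff]
  contrapose! hl
  simp only [Set.mem_compl_iff, Set.mem_ofPred_eq, not_not]
  intro z hz
  exact norm_sigmaFactor_sub_one_le Ω (by simpa using (Metric.ball_subset_closedBall hz)) hl.le

lemma tendstoLocallyUniformlyOn_sigmaProd :
    TendstoLocallyUniformlyOn (fun (s : Finset Ω.lattice) z ↦ ∏ l ∈ s, sigmaFactor Ω l z)
      (sigmaProd Ω) atTop Set.univ := by
  refine tendstoLocallyUniformlyOn_of_forall_exists_nhds fun z _ ↦
    ⟨Metric.ball 0 (‖z‖ + 1), mem_nhdsWithin_of_mem_nhds (Metric.isOpen_ball.mem_nhds (by simp)), ?_⟩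
  refine TendstoUniformlyOn.mono ?_ Metric.ball_subset_closedBall
  have := Summable.hasProdUniformlyOn_one_add (f := fun l z ↦ sigmaFactor Ω l z - 1)
    (isCompact_closedBall (0 : ℂ) (‖z‖ + 1)) (summable_sigmaFactor_bound Ω (‖z‖ + 2))
    ((eventually_norm_sigmaFactor_sub_one_le Ω (‖z‖ + 2)).mono fun l hl w hw ↦
      hl w (Metric.closedBall_subset_ball (by linarith) hw))
    (fun l ↦ ((differentiable_sigmaFactor Ω l).continuous.sub continuous_const).continuousOn)
  simp only [hasProdUniformlyOn_iff_tendstoUniformlyOn, add_sub_cancel] at this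
  exact this

lemma differentiable_sigmaProd : Differentiable ℂ (sigmaProd Ω) := by
  rw [← differentiableOn_univ]
  refine (tendstoLocallyUniformlyOn_sigmaProd Ω).differentiableOn (.of_forall fun s ↦ ?_) isOpen_univ
  exact (Differentiable.fun_finsetProd fun l _ ↦ differentiable_sigmaFactor Ω l).differentiableOn

lemma differentiable_sigma : Differentiable ℂ (sigma Ω) :=
  differentiable_id.mul (differentiable_sigmaProd Ω)

@[fun_prop]
lemma continuous_sigma : Continuous (sigma Ω) := (differentiable_sigma Ω).continuous

lemma sigmaProd_zero : sigmaProd Ω 0 = 1 := by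
  simp [sigmaProd, sigmaFactor]

lemma sigmaProd_neg (z : ℂ) : sigmaProd Ω (-z) = sigmaProd Ω z := by
  rw [sigmaProd, ← (Equiv.neg Ω.lattice).tprod_eq, sigmaProd]
  congr! 2 with l
  simp [sigmaFactor]

lemma sigma_neg (z : ℂ) : sigma Ω (-z) = -sigma Ω z := by
  rw [sigma_eq_mul_sigmaProd, sigma_eq_mul_sigmaProd, sigmaProd_neg, neg_mul]

lemma sigmaProd_ne_zero {z : ℂ} (hz : z ∉ Ω.lattice ∨ z = 0) : sigmaProd Ω z ≠ 0 := by
  have h := tprod_one_add_ne_zero_of_summable (f := fun l ↦ sigmaFactor Ω l z - 1)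
    (fun l ↦ by simpa using sigmaFactor_ne_zero Ω hz) ?_
  · simpa [sigmaProd] using h
  · refine Summable.of_norm_bounded_eventually (g := _) (summable_sigmaFactor_bound Ω (‖z‖ + 1)) ?_
    filter_upwards [eventually_norm_sigmaFactor_sub_one_le Ω (‖z‖ + 1)] with l hl
    simpa using hl z (by simp)

lemma sigma_eq_zero_iff {z : ℂ} : sigma Ω z = 0 ↔ z ∈ Ω.lattice := by
  constructor
  · contrapose!
    intro hz
    exact mul_ne_zero (by rintro rfl; exact hz (zero_mem _)) (sigmaProd_ne_zero Ω (.inl hz))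
  · intro hz
    rw [sigma_eq_mul_sigmaProd]
    by_cases h0 : z = 0
    · simp [h0]
    · rw [sigmaProd, tprod_of_exists_eq_zero, mul_zero]
      exact ⟨⟨z, hz⟩, by simp [sigmaFactor, h0]⟩

lemma sigma_ne_zero {z : ℂ} (hz : z ∉ Ω.lattice) : sigma Ω z ≠ 0 :=
  mt (sigma_eq_zero_iff Ω).mp hz

end

/-! ### The logarithmic derivative and quasi-periodicity of `σ` -/

section

variable (Ω : PeriodPair)

lemma isOpen_compl_lattice : IsOpen ((Ω.lattice : Set ℂ)ᶜ) := Ω.isClosed_lattice.isOpen_compl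

lemma countable_lattice : (Ω.lattice : Set ℂ).Countable :=
  have : Countable Ω.lattice := Ω.latticeEquivProd.toEquiv.injective.countable
  this

lemma isPreconnected_compl_lattice : IsPreconnected ((Ω.lattice : Set ℂ)ᶜ) :=
  ((countable_lattice Ω).isConnected_compl_of_one_lt_rank (by simp)).isPreconnected

lemma dense_compl_lattice : Dense ((Ω.lattice : Set ℂ)ᶜ) :=
  (countable_lattice Ω).dense_compl ℝ

lemma hasDerivAt_sigmaFactor {l : Ω.lattice} (hl : l ≠ 0) (z : ℂ) :
    HasDerivAt (sigmaFactor Ω l)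
      (-(z ^ 2 / (l : ℂ) ^ 3) * exp (z / (l : ℂ) + z ^ 2 / (2 * (l : ℂ) ^ 2))) z := by
  have hl' : (l : ℂ) ≠ 0 := by simpa using hl
  have h1 : HasDerivAt (fun z : ℂ ↦ z / (l : ℂ) + z ^ 2 / (2 * (l : ℂ) ^ 2))
      (1 / l + z / l ^ 2) z :=
    (((hasDerivAt_id z).div_const (l : ℂ)).add
      ((hasDerivAt_pow 2 z).div_const (2 * (l : ℂ) ^ 2))).congr_deriv (by simp; field)
  refine ((((hasDerivAt_id z).div_const (l : ℂ)).const_sub 1).mul h1.cexp).congr_deriv ?_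
  simp only [id]; field

lemma logDeriv_sigmaFactor {l : Ω.lattice} (hl : l ≠ 0) {z : ℂ} (hz : z ∉ Ω.lattice) :
    logDeriv (sigmaFactor Ω l) z = 1 / (z - l) + 1 / l + z / l ^ 2 := by
  have hl' : (l : ℂ) ≠ 0 := by simpa using hl
  have h1 : z - l ≠ 0 := fun h ↦ hz (by rw [sub_eq_zero.mp h]; exact l.2)
  have h2 : (l : ℂ) - z ≠ 0 := by rwa [← neg_sub, neg_ne_zero]
  have h3 := exp_ne_zero (z / (l : ℂ) + z ^ 2 / (2 * (l : ℂ) ^ 2))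
  rw [logDeriv_apply, (hasDerivAt_sigmaFactor Ω hl z).deriv, sigmaFactor, mul_div_mul_right _ _ h3,
    one_sub_div hl', ← neg_sub z (l : ℂ)]
  field

lemma hasDerivAt_logDeriv_sigmaFactor (l : Ω.lattice) {z : ℂ} (hz : z ∉ Ω.lattice) :
    HasDerivAt (logDeriv (sigmaFactor Ω l))
      (-(if (l : ℂ) = 0 then 0 else (1 / (z - l) ^ 2 - 1 / (l : ℂ) ^ 2))) z := by
  by_cases hl : l = 0
  · subst hl
    have : sigmaFactor Ω 0 = fun _ ↦ 1 := funext (sigmaFactor_zero Ω)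
    rw [this]
    simp
  have hl' : (l : ℂ) ≠ 0 := by simpa using hl
  have h1 : z - l ≠ 0 := fun h ↦ hz (by rw [sub_eq_zero.mp h]; exact l.2)
  have h := ((((hasDerivAt_id z).sub_const (l : ℂ)).inv h1).add_const (1 / (l : ℂ))).add
    ((hasDerivAt_id z).div_const ((l : ℂ) ^ 2))
  rw [if_neg hl']
  refine (h.congr_of_eventuallyEq ?_).congr_deriv ?_
  · filter_upwards [(isOpen_compl_lattice Ω).mem_nhds hz] with w hw
    simp [logDeriv_sigmaFactor Ω hl hw]
  · simp only [id]; ring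

/-- The second derivative of the logarithm of `f`, in terms of derivatives of `f`. -/
lemma hasDerivAt_logDeriv {f : ℂ → ℂ} (hf : Differentiable ℂ f) {z : ℂ} (hz : f z ≠ 0) :
    HasDerivAt (logDeriv f)
      ((deriv (deriv f) z * f z - deriv f z * deriv f z) / f z ^ 2) z :=
  (hf.deriv z).hasDerivAt.div (hf z).hasDerivAt hz

/-- `(log (σ(z) / z))'' = -(℘(z) - z⁻²)`: the finite partial products converge locally
uniformly together with all their derivatives, and their second logarithmic derivatives are the
partial sums of the series of `℘`. -/
lemma hasDerivAt_logDeriv_sigmaProd {z : ℂ} (hz : z ∉ Ω.lattice) :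
    HasDerivAt (logDeriv (sigmaProd Ω)) (-Ω.weierstrassPExcept 0 z) z := by
  have hP := sigmaProd_ne_zero Ω (.inl hz)
  refine (hasDerivAt_logDeriv (differentiable_sigmaProd Ω) hP).congr_deriv ?_
  let p (s : Finset Ω.lattice) (z : ℂ) : ℂ := ∏ l ∈ s, sigmaFactor Ω l z
  have hp (s) : Differentiable ℂ (p s) :=
    Differentiable.fun_finsetProd fun l _ ↦ differentiable_sigmaFactor Ω l
  have t0 : TendstoLocallyUniformlyOn p (sigmaProd Ω) atTop Set.univ :=
    tendstoLocallyUniformlyOn_sigmaProd Ω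
  have t1 := t0.deriv (.of_forall fun s ↦ (hp s).differentiableOn) isOpen_univ
  have t2 := t1.deriv (.of_forall fun s ↦ (hp s).deriv.differentiableOn) isOpen_univ
  have u0 := t0.tendsto_at (Set.mem_univ z)
  have u1 := t1.tendsto_at (Set.mem_univ z)
  have u2 := t2.tendsto_at (Set.mem_univ z)
  refine tendsto_nhds_unique (((u2.mul u0).sub (u1.mul u1)).div (u0.pow 2) (pow_ne_zero 2 hP)) ?_
  refine ((Ω.hasSum_weierstrassPExcept 0 z).neg).congr fun s ↦ ?_
  have hps : p s z ≠ 0 := Finset.prod_ne_zero_iff.mpr fun l _ ↦ sigmaFactor_ne_zero Ω (.inl hz)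
  refine HasDerivAt.unique (f := logDeriv (p s)) (x := z) ?_ (hasDerivAt_logDeriv (hp s) hps)
  refine (HasDerivAt.fun_sum fun l _ ↦ hasDerivAt_logDeriv_sigmaFactor Ω l hz).congr_of_eventuallyEq ?_
  filter_upwards [(isOpen_compl_lattice Ω).mem_nhds hz] with w hw
  exact logDeriv_prod (fun l _ ↦ sigmaFactor_ne_zero Ω (.inl hw))
    (fun l _ ↦ differentiable_sigmaFactor Ω l w)

/-- `(log σ)'' = -℘`. -/
lemma hasDerivAt_logDeriv_sigma {z : ℂ} (hz : z ∉ Ω.lattice) :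
    HasDerivAt (logDeriv (sigma Ω)) (-Ω.weierstrassP z) z := by
  have h0 : z ≠ 0 := by rintro rfl; exact hz (zero_mem _)
  refine ((((hasDerivAt_id z).inv h0).add (hasDerivAt_logDeriv_sigmaProd Ω hz)).congr_of_eventuallyEq
    ?_).congr_deriv ?_
  · filter_upwards [(isOpen_compl_lattice Ω).mem_nhds hz] with w hw
    have hw0 : w ≠ 0 := by rintro rfl; exact hw (zero_mem _)
    have := logDeriv_mul (f := id) w hw0 (sigmaProd_ne_zero Ω (.inl hw)) differentiableAt_id
      (differentiable_sigmaProd Ω w)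
    refine (Eq.trans ?_ this).trans ?_
    · rfl
    · simp [logDeriv_apply]
  · have := Ω.weierstrassPExcept_add 0 z
    simp at this
    rw [← this]
    simp only [id]; ring

lemma add_mem_lattice_iff {z l : ℂ} (hl : l ∈ Ω.lattice) : z + l ∈ Ω.lattice ↔ z ∈ Ω.lattice :=
  Ω.lattice.toAddSubgroup.add_mem_cancel_right hl

/-- Translation by a period multiplies `σ` by an exponential, because `(log σ)'' = -℘` is
periodic and the complement of the lattice is connected. -/
lemma exists_sigma_add_eq {l : ℂ} (hl : l ∈ Ω.lattice) :
    ∃ η C : ℂ, C ≠ 0 ∧ ∀ z, sigma Ω (z + l) = C * exp (η * z) * sigma Ω z := by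
  have hadd {z : ℂ} (hz : z ∉ Ω.lattice) : z + l ∉ Ω.lattice := by
    rwa [add_mem_lattice_iff Ω hl]
  have hd {z : ℂ} (hz : z ∉ Ω.lattice) :
      HasDerivAt (fun z ↦ logDeriv (sigma Ω) (z + l) - logDeriv (sigma Ω) z) 0 z := by
    refine (((hasDerivAt_logDeriv_sigma Ω (hadd hz)).comp_add_const z l).sub
      (hasDerivAt_logDeriv_sigma Ω hz)).congr_deriv ?_
    rw [Ω.weierstrassP_add_coe z ⟨l, hl⟩, sub_self]
  obtain ⟨η, hη⟩ := (isOpen_compl_lattice Ω).exists_is_const_of_deriv_eq_zero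
    (isPreconnected_compl_lattice Ω) (fun z hz ↦ (hd hz).differentiableAt.differentiableWithinAt)
    (fun z hz ↦ (hd hz).deriv)
  have hd' {z : ℂ} (hz : z ∉ Ω.lattice) :
      HasDerivAt (fun z ↦ sigma Ω (z + l) * exp (-(η * z)) / sigma Ω z) 0 z := by
    have h1 := ((differentiable_sigma Ω) (z + l)).hasDerivAt.comp_add_const z l
    have h2 : HasDerivAt (fun z ↦ exp (-(η * z))) (exp (-(η * z)) * -η) z :=
      (((hasDerivAt_id z).const_mul η).neg.congr_deriv (by simp)).cexp
    refine ((h1.mul h2).div (differentiable_sigma Ω z).hasDerivAt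
      (sigma_ne_zero Ω hz)).congr_deriv ?_
    have h3 := hη z hz
    have h4 := sigma_ne_zero Ω hz
    have h5 := sigma_ne_zero Ω (hadd hz)
    simp only [logDeriv_apply] at h3
    have h6 : deriv (sigma Ω) (z + l) * sigma Ω z - deriv (sigma Ω) z * sigma Ω (z + l)
        = η * sigma Ω (z + l) * sigma Ω z := by
      rw [← h3]; field
    simp only [Pi.mul_apply]
    rw [div_eq_zero_iff]
    left
    linear_combination exp (-(η * z)) * h6
  obtain ⟨C, hC⟩ := (isOpen_compl_lattice Ω).exists_is_const_of_deriv_eq_zero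
    (isPreconnected_compl_lattice Ω) (fun z hz ↦ (hd' hz).differentiableAt.differentiableWithinAt)
    (fun z hz ↦ (hd' hz).deriv)
  refine ⟨η, C, ?_, fun z ↦ ?_⟩
  · obtain ⟨z, hz⟩ := (dense_compl_lattice Ω).nonempty
    rw [← hC z hz]
    exact div_ne_zero (mul_ne_zero (sigma_ne_zero Ω (hadd hz)) (exp_ne_zero _)) (sigma_ne_zero Ω hz)
  · by_cases hz : z ∈ Ω.lattice
    · rw [(sigma_eq_zero_iff Ω).mpr hz, (sigma_eq_zero_iff Ω).mpr (add_mem hz hl), mul_zero]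
    · rw [← hC z hz, exp_neg]
      field [sigma_ne_zero Ω hz, exp_ne_zero (η * z)]

end

/-! ### The addition formula and the three-term identity -/

section

variable (Ω : PeriodPair)

/-- An even function that is holomorphic near `0` and vanishes there is `u²` times a holomorphic
function. -/
lemma exists_eq_sq_mul_of_even {N : ℂ → ℂ} {V : Set ℂ} (hV : V ∈ 𝓝 0) (hN : DifferentiableOn ℂ N V)
    (heven : ∀ u, N (-u) = N u) (h0 : N 0 = 0) :
    ∃ D : ℂ → ℂ, DifferentiableAt ℂ D 0 ∧ ∀ u, N u = u ^ 2 * D u := by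
  have hodd : deriv N 0 = 0 := by
    have := deriv_comp_neg N 0
    simp only [heven, neg_zero] at this
    exact CharZero.eq_neg_self_iff.mp this
  have hD := (differentiableOn_dslope hV).mpr ((differentiableOn_dslope hV).mpr hN)
  refine ⟨dslope (dslope N 0) 0, hD.differentiableAt hV, fun u ↦ ?_⟩
  have h1 := sub_smul_dslope N 0 u
  have h2 := sub_smul_dslope (dslope N 0) 0 u
  simp only [sub_zero, smul_eq_mul, h0, dslope_same, hodd] at h1 h2
  rw [← h1, ← h2]; ring

open Classical in
/-- The function `σ(u+v) σ(u-v) / (σ(u)² σ(v)²) + ℘(u)` of `u`, with the value `c` at its removable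
singularities, the lattice points. -/
noncomputable def additionFun (v c u : ℂ) : ℂ :=
  if u ∈ Ω.lattice then c else
    sigma Ω (u + v) * sigma Ω (u - v) / (sigma Ω u ^ 2 * sigma Ω v ^ 2) + Ω.weierstrassP u

lemma additionFun_add_coe (v c u : ℂ) {l : ℂ} (hl : l ∈ Ω.lattice) :
    additionFun Ω v c (u + l) = additionFun Ω v c u := by
  by_cases hu : u ∈ Ω.lattice
  · rw [additionFun, additionFun, if_pos hu, if_pos (add_mem hu hl)]
  obtain ⟨η, C, hC, h⟩ := exists_sigma_add_eq Ω hl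
  rw [additionFun, additionFun, if_neg hu, if_neg (by rwa [add_mem_lattice_iff Ω hl]),
    Ω.weierstrassP_add_coe u ⟨l, hl⟩, add_right_comm, add_sub_right_comm, h, h, h]
  congr 1
  have h1 : exp (η * (u + v)) * exp (η * (u - v)) = exp (η * u) ^ 2 := by
    rw [← exp_add, sq, ← exp_add]; ring_nf
  have h2 := exp_ne_zero (η * u)
  calc _ = (C ^ 2 * (exp (η * (u + v)) * exp (η * (u - v)))) *
        (sigma Ω (u + v) * sigma Ω (u - v)) /
        ((C ^ 2 * exp (η * u) ^ 2) * (sigma Ω u ^ 2 * sigma Ω v ^ 2)) := by ring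
    _ = _ := by rw [h1, mul_div_mul_left]; positivity

/-- At `u = 0` the double pole of `σ(u+v) σ(u-v) / (σ(u)² σ(v)²)` cancels that of `℘(u)`, and there
are no simple poles because both functions are even. -/
lemma exists_differentiableAt_additionFun_zero {v : ℂ} (hv : v ∉ Ω.lattice) :
    ∃ c, DifferentiableAt ℂ (additionFun Ω v c) 0 := by
  have hσv := sigma_ne_zero Ω hv
  let N (u : ℂ) : ℂ := sigma Ω (u + v) * sigma Ω (u - v) +
    sigma Ω v ^ 2 * sigmaProd Ω u ^ 2 * (1 + u ^ 2 * Ω.weierstrassPExcept 0 u)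
  have hV := Ω.compl_lattice_sdiff_singleton_mem_nhds 0
  have hN : DifferentiableOn ℂ N (Ω.lattice \ {0} : Set ℂ)ᶜ := by
    have h1 := differentiable_sigma Ω
    have h2 := differentiable_sigmaProd Ω
    have h3 := Ω.differentiableOn_weierstrassPExcept 0
    have h4 : Differentiable ℂ fun u ↦ sigma Ω (u + v) * sigma Ω (u - v) := by fun_prop
    exact h4.differentiableOn.add (((h2.pow 2).const_mul _).differentiableOn.mul
      ((differentiableOn_const _).add ((differentiable_id.pow 2).differentiableOn.mul h3)))
  obtain ⟨D, hD, hND⟩ := exists_eq_sq_mul_of_even hV hN (fun u ↦ by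
    simp only [N]
    rw [sigmaProd_neg, Ω.weierstrassPExcept_neg, neg_zero, neg_sq, neg_add_eq_sub,
      ← neg_sub u v, ← neg_add', sigma_neg, sigma_neg]
    ring) (by simp [N, sigma_neg, sigmaProd_zero]; ring)
  refine ⟨D 0 / sigma Ω v ^ 2, ?_⟩
  have hd : DifferentiableAt ℂ (fun u ↦ D u / (sigmaProd Ω u ^ 2 * sigma Ω v ^ 2)) 0 :=
    hD.div (((differentiable_sigmaProd Ω).pow 2).mul_const _ 0) (by simpa [sigmaProd_zero])
  refine hd.congr_of_eventuallyEq ?_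
  filter_upwards [hV] with u hu
  by_cases h0 : u = 0
  · subst h0; simp [additionFun, sigmaProd_zero]
  have hu : u ∉ Ω.lattice := by simpa [h0] using hu
  have h1 := hND u
  have h2 := sigmaProd_ne_zero Ω (.inl hu)
  have h3 := Ω.weierstrassPExcept_add 0 u
  simp only [N] at h1
  simp at h3
  rw [additionFun, if_neg hu, ← h3, sigma_eq_mul_sigmaProd Ω u]
  field_simp
  linear_combination h1

lemma differentiable_additionFun {v c : ℂ} (hv : v ∉ Ω.lattice)
    (h0 : DifferentiableAt ℂ (additionFun Ω v c) 0) : Differentiable ℂ (additionFun Ω v c) := by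
  intro x
  by_cases hx : x ∈ Ω.lattice
  · have h1 : additionFun Ω v c = fun u ↦ additionFun Ω v c (u + -x) :=
      funext fun u ↦ (additionFun_add_coe Ω v c u (neg_mem hx)).symm
    rw [h1]
    rw [← add_neg_cancel x] at h0
    exact DifferentiableAt.comp x h0 (differentiableAt_id.add_const (-x))
  · have h1 := differentiable_sigma Ω
    have h2 : DifferentiableAt ℂ Ω.weierstrassP x :=
      (Ω.analyticOnNhd_weierstrassP x hx).differentiableAt
    have h3 := sigma_ne_zero Ω hx
    have h4 := sigma_ne_zero Ω hv
    have h5 : DifferentiableAt ℂ (fun u ↦ sigma Ω (u + v) * sigma Ω (u - v) /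
        (sigma Ω u ^ 2 * sigma Ω v ^ 2) + Ω.weierstrassP u) x := by
      refine DifferentiableAt.add (DifferentiableAt.div ?_ ?_ (by positivity)) h2
      · exact Differentiable.differentiableAt (by fun_prop)
      · exact Differentiable.differentiableAt (by fun_prop)
    refine h5.congr_of_eventuallyEq ?_
    filter_upwards [(isOpen_compl_lattice Ω).mem_nhds hx] with w hw
    exact if_neg hw

/-- The addition formula `σ(u+v) σ(u-v) = -σ(u)² σ(v)² (℘(u) - ℘(v))`. By Liouville's theorem
`additionFun` is constant, and its value at `u = v` is `℘(v)`. -/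
theorem sigma_add_mul_sigma_sub {u v : ℂ} (hu : u ∉ Ω.lattice) (hv : v ∉ Ω.lattice) :
    sigma Ω (u + v) * sigma Ω (u - v) =
      -(sigma Ω u ^ 2 * sigma Ω v ^ 2 * (Ω.weierstrassP u - Ω.weierstrassP v)) := by
  obtain ⟨c, h0⟩ := exists_differentiableAt_additionFun_zero Ω hv
  have hd := differentiable_additionFun Ω hv h0
  have h := hd.apply_eq_apply_of_bounded (IsZLattice.isCompact_range_of_periodic Ω.lattice _
    hd.continuous fun z w hw ↦ additionFun_add_coe Ω v c z hw).isBounded u v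
  rw [additionFun, additionFun, if_neg hu, if_neg hv, sub_self,
    (sigma_eq_zero_iff Ω).mpr (zero_mem _), mul_zero, zero_div, zero_add] at h
  have h3 := sigma_ne_zero Ω hu
  have h4 := sigma_ne_zero Ω hv
  field_simp at h
  linear_combination h

/-- Weierstrass's three-term identity. Away from the lattice it is the identity
`(A - B) (C - D) + (B - C) (A - D) + (C - A) (B - D) = 0` for the values of `℘`. -/
theorem sigma_three_term (a b c d : ℂ) :
    sigma Ω (a + b) * sigma Ω (a - b) * (sigma Ω (c + d) * sigma Ω (c - d)) +
      sigma Ω (b + c) * sigma Ω (b - c) * (sigma Ω (a + d) * sigma Ω (a - d)) +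
      sigma Ω (c + a) * sigma Ω (c - a) * (sigma Ω (b + d) * sigma Ω (b - d)) = 0 := by
  have key {f : ℂ → ℂ} (hf : Continuous f) (h : ∀ z ∉ Ω.lattice, f z = 0) (z : ℂ) : f z = 0 :=
    congrFun (hf.ext_on (dense_compl_lattice Ω) continuous_const fun z hz ↦ h z hz) z
  revert d
  refine key (by fun_prop) fun d hd ↦ ?_
  revert c
  refine key (by fun_prop) fun c hc ↦ ?_
  revert b
  refine key (by fun_prop) fun b hb ↦ ?_
  revert a
  refine key (by fun_prop) fun a ha ↦ ?_
  simp only [sigma_add_mul_sigma_sub Ω, ha, hb, hc, hd, not_false_eq_true]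
  ring

/-- A symmetric form of the three-term identity. -/
theorem sigma_four_product (X a₁ a₂ a₃ a₄ : ℂ) (h : a₁ + a₂ + a₃ + a₄ = 0) :
    sigma Ω (X + a₁) * sigma Ω (X + a₂) * sigma Ω (X + a₃) * sigma Ω (X + a₄) -
      sigma Ω (X - a₁) * sigma Ω (X - a₂) * sigma Ω (X - a₃) * sigma Ω (X - a₄) =
      sigma Ω (2 * X) * sigma Ω (a₁ + a₂) * sigma Ω (a₁ + a₃) * sigma Ω (a₁ + a₄) := by
  obtain rfl : a₄ = -(a₁ + a₂ + a₃) := by linear_combination h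
  have := sigma_three_term Ω (X + (a₁ + a₂) / 2) ((a₁ - a₂) / 2) (X - (a₁ + a₂) / 2)
    (a₃ + (a₁ + a₂) / 2)
  have e1 : (a₁ - a₂) / 2 - (X - (a₁ + a₂) / 2) = -(X - a₁) := by ring
  have e2 : X - (a₁ + a₂) / 2 - (X + (a₁ + a₂) / 2) = -(a₁ + a₂) := by ring
  rw [e1, e2, sigma_neg, sigma_neg] at this
  ring_nf at this ⊢
  linear_combination this

end

/-! ### The rank one structure of the matrices -/

section

variable (Ω : PeriodPair)

/-- The determinant of two vectors of `ℂ²`. -/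
def wedge (v w : Fin 2 → ℂ) : ℂ := v 0 * w 1 - v 1 * w 0

lemma wedge_sub_right (u v w : Fin 2 → ℂ) : wedge u (v - w) = wedge u v - wedge u w := by
  simp [wedge]; ring

lemma wedge_smul_right (u v : Fin 2 → ℂ) (a : ℂ) : wedge u (a • v) = a * wedge u v := by
  simp [wedge]; ring

lemma wedge_self (u : Fin 2 → ℂ) : wedge u u = 0 := by simp [wedge]; ring

lemma eq_of_wedge_eq {a b v w : Fin 2 → ℂ} (hab : wedge a b ≠ 0) (ha : wedge a v = wedge a w)
    (hb : wedge b v = wedge b w) : v = w := by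
  simp only [wedge] at *
  ext i
  fin_cases i
  · refine mul_left_cancel₀ hab ?_
    simp only [Fin.zero_eta]
    linear_combination b 0 * ha - a 0 * hb
  · refine mul_left_cancel₀ hab ?_
    simp only [Fin.mk_one]
    linear_combination b 1 * ha - a 1 * hb

lemma matrix_eq_of_mulVec_eq {a b : Fin 2 → ℂ} {A B : Matrix (Fin 2) (Fin 2) ℂ}
    (hab : wedge a b ≠ 0) (ha : A.mulVec a = B.mulVec a) (hb : A.mulVec b = B.mulVec b) :
    A = B := by
  have ha' := fun i ↦ congrFun ha i
  have hb' := fun i ↦ congrFun hb i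
  simp only [Matrix.mulVec, dotProduct, Fin.sum_univ_two] at ha' hb'
  simp only [wedge] at hab
  ext i j
  fin_cases j
  · refine mul_left_cancel₀ hab ?_
    simp only [Fin.zero_eta]
    linear_combination b 1 * ha' i - a 1 * hb' i
  · refine mul_left_cancel₀ hab ?_
    simp only [Fin.mk_one]
    linear_combination a 0 * hb' i - b 0 * ha' i

/-- The vector `σ(z)² (℘(z), 1)`, for `z` outside the lattice. -/
noncomputable def psi (z : ℂ) : Fin 2 → ℂ :=
  ![sigma Ω z ^ 2 * Ω.weierstrassP z, sigma Ω z ^ 2]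

lemma psi_neg (z : ℂ) : psi Ω (-z) = psi Ω z := by
  simp [psi, sigma_neg, Ω.weierstrassP_neg]

lemma wedge_psi {b c : ℂ} (hb : b ∉ Ω.lattice) (hc : c ∉ Ω.lattice) :
    wedge (psi Ω b) (psi Ω c) = -(sigma Ω (b + c) * sigma Ω (b - c)) := by
  rw [sigma_add_mul_sigma_sub Ω hb hc]
  simp [wedge, psi]; ring

/-- `M(x, β; λ)` has rank one: it is a multiple of `ψ(x+λ-β) ⊗ ψ(x-λ)^⊥`. -/
lemma matM_mulVec (x β lam : ℂ) (w : Fin 2 → ℂ) :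
    (matM Ω x β lam).mulVec w =
      (wedge (psi Ω (x - lam)) w / (sigma Ω (2 * x) * sigma Ω (2 * lam))) •
        psi Ω (x + lam - β) := by
  ext i
  fin_cases i <;>
    simp [matM, Matrix.mulVec, dotProduct, Fin.sum_univ_two, wedge, psi] <;>
    ring

lemma matM_neg_left (x β lam : ℂ) : matM Ω (-x) β lam = matM Ω x (-β) (-lam) := by
  have e1 : -x + lam - β = -(x + -lam - -β) := by ring
  have e2 : -x - lam = -(x - -lam) := by ring
  rw [matM, matM, e1, e2, mul_neg, mul_neg, sigma_neg, sigma_neg, sigma_neg, sigma_neg,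
    Ω.weierstrassP_neg, Ω.weierstrassP_neg]
  simp only [neg_sq, neg_mul, mul_neg]

lemma matV_eq_matL (x g ε lam : ℂ) : matV Ω x g ε lam = matL Ω x g ε lam := rfl

lemma matL_neg_neg (x p β lam : ℂ) : matL Ω x (-p) (-β) (-lam) = matL Ω x p β lam := by
  simp only [matL, neg_neg]
  rw [add_comm]

/-- `L` depends on `(x, p)` only up to a common sign: the reversal exchanges its two summands. -/
lemma matL_neg_left (x p β lam : ℂ) : matL Ω (-x) (-p) β lam = matL Ω x p β lam := by
  simp only [matL, matM_neg_left, neg_neg]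
  rw [add_comm]

lemma matL_mulVec (x p β lam : ℂ) (w : Fin 2 → ℂ) :
    (matL Ω x p β lam).mulVec w =
      (exp p * wedge (psi Ω (x - lam)) w / (sigma Ω (2 * x) * sigma Ω (2 * lam))) •
          psi Ω (x + lam - β) -
        (exp (-p) * wedge (psi Ω (x + lam)) w / (sigma Ω (2 * x) * sigma Ω (2 * lam))) •
          psi Ω (x - lam + β) := by
  have e1 : x + -lam - -β = x - lam + β := by ring
  rw [matL, Matrix.add_mulVec, Matrix.smul_mulVec, Matrix.smul_mulVec, matM_mulVec, matM_mulVec,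
    smul_smul, smul_smul, e1, sub_neg_eq_add, mul_neg 2 lam, sigma_neg, sub_eq_add_neg _ (_ • _),
    ← neg_smul]
  congr 2
  · ring
  · rw [mul_neg, div_neg]; ring

/-- The matrix `L` maps `ψ(x + λ)` to `e^p ψ(x + λ - β)`. -/
lemma matL_mulVec_psi {x lam : ℂ} (p β : ℂ) (h2x : 2 * x ∉ Ω.lattice) (h2l : 2 * lam ∉ Ω.lattice)
    (hp : x + lam ∉ Ω.lattice) (hm : x - lam ∉ Ω.lattice) :
    (matL Ω x p β lam).mulVec (psi Ω (x + lam)) = exp p • psi Ω (x + lam - β) := by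
  rw [matL_mulVec, wedge_self, wedge_psi Ω hm hp]
  have e1 : x - lam + (x + lam) = 2 * x := by ring
  have e2 : x - lam - (x + lam) = -(2 * lam) := by ring
  have h1 := sigma_ne_zero Ω h2x
  have h2 := sigma_ne_zero Ω h2l
  rw [e1, e2, sigma_neg, mul_zero, zero_div, zero_smul, sub_zero, mul_neg, mul_neg, mul_neg, neg_neg,
    mul_div_cancel_right₀ _ (mul_ne_zero h1 h2)]

/-- The relation between the three fields `x, x̃, x₁` of a triangle which expresses that the two
vectors `L̃ V ψ(x+λ)` and `c V₁ L ψ(x+λ)` have the same determinant with `ψ(x̃+λ-β)`. The numbers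
`E, T, G, G₁` stand for `e^p, e^p̃, e^g, e^g₁`. -/
def CellRel (x xt x1 β ε E T G G1 c : ℂ) : Prop :=
  G * (sigma Ω (x - xt - ε) * sigma Ω (x1 + x + β) * sigma Ω (x1 - xt - (β - ε))) =
    c * (E * T * G1) * (sigma Ω (x - xt + ε) * sigma Ω (x1 + x - β) * sigma Ω (x1 - xt + (β - ε)))

/-- The equation for `e^{2 g₁}` without denominators. -/
def EpsGRel (x xt x1 β ε G1 : ℂ) : Prop :=
  G1 ^ 2 * (sigma Ω (x1 + x - β) * sigma Ω (x1 - x - β) *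
      (sigma Ω (x1 + xt + (β - ε)) * sigma Ω (x1 - xt + (β - ε)))) =
    sigma Ω (x1 + x + β) * sigma Ω (x1 - x + β) *
      (sigma Ω (x1 + xt - (β - ε)) * sigma Ω (x1 - xt - (β - ε)))

variable {Ω}

/-- `EpsGRel` is invariant under the reversal of all signs except those of the fields. -/
lemma EpsGRel.neg {x xt x1 β ε G1 : ℂ} (h : EpsGRel Ω x xt x1 β ε G1) (hG : G1 ≠ 0) :
    EpsGRel Ω x xt x1 (-β) (-ε) G1⁻¹ := by
  simp only [EpsGRel] at *
  have e : -β - -ε = -(β - ε) := by ring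
  rw [e, ← sub_eq_add_neg, ← sub_eq_add_neg, ← sub_eq_add_neg, ← sub_eq_add_neg]
  simp only [sub_neg_eq_add]
  field_simp
  linear_combination -h

lemma EpsGRel.neg_tilde {x xt x1 β ε G1 : ℂ} (h : EpsGRel Ω x xt x1 β ε G1) :
    EpsGRel Ω x (-xt) x1 β ε G1 := by
  simp only [EpsGRel] at *
  simp only [sub_neg_eq_add, ← sub_eq_add_neg]
  linear_combination h

/-- `CellRel` is invariant under the reversal of all signs except those of the fields. This is
why the vector `ψ(x-λ)` gives no relations beyond those from `ψ(x+λ)`. -/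
lemma CellRel.neg {x xt x1 β ε E T G G1 c : ℂ} (h : CellRel Ω x xt x1 β ε E T G G1 c)
    (hE : E ≠ 0) (hT : T ≠ 0) (hG : G ≠ 0) (hG1 : G1 ≠ 0) (hc : c = 1 ∨ c = -1) :
    CellRel Ω x xt x1 (-β) (-ε) E⁻¹ T⁻¹ G⁻¹ G1⁻¹ c := by
  simp only [CellRel] at *
  have e : -β - -ε = -(β - ε) := by ring
  rw [e, ← sub_eq_add_neg, ← sub_eq_add_neg, ← sub_eq_add_neg]
  simp only [sub_neg_eq_add]
  field_simp
  rcases hc with rfl | rfl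
  · linear_combination -h
  · linear_combination h

variable (Ω)

/-- The spectral parameter avoids the poles relevant for the action of the matrices on the
vectors `ψ(x ± λ)`. -/
structure CellAdmissible (x xt x1 β ε lam : ℂ) : Prop where
  two_x : 2 * x ∉ Ω.lattice
  two_xt : 2 * xt ∉ Ω.lattice
  two_x1 : 2 * x1 ∉ Ω.lattice
  two_lam : 2 * lam ∉ Ω.lattice
  x_add : x + lam ∉ Ω.lattice
  x_sub : x - lam ∉ Ω.lattice
  xt_add : xt + lam ∉ Ω.lattice
  xt_sub : xt - lam ∉ Ω.lattice
  x1_add : x1 + lam ∉ Ω.lattice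
  x1_sub : x1 - lam ∉ Ω.lattice
  x_eps : x + lam - ε ∉ Ω.lattice
  x_eps' : x - lam + ε ∉ Ω.lattice
  x_beta : x + lam - β ∉ Ω.lattice
  x_beta' : x - lam + β ∉ Ω.lattice
  xt_beta : xt + lam - β ∉ Ω.lattice
  xt_beta' : xt - lam + β ∉ Ω.lattice
  x1_eps : x1 + lam - ε ∉ Ω.lattice
  x1_eps' : x1 - lam + ε ∉ Ω.lattice

variable {Ω}

lemma neg_mem_lattice_iff {z : ℂ} : -z ∈ Ω.lattice ↔ z ∈ Ω.lattice := Ω.lattice.neg_mem_iff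

lemma CellAdmissible.neg {x xt x1 β ε lam : ℂ} (h : CellAdmissible Ω x xt x1 β ε lam) :
    CellAdmissible Ω x xt x1 (-β) (-ε) (-lam) where
  two_x := h.two_x
  two_xt := h.two_xt
  two_x1 := h.two_x1
  two_lam := by rw [mul_neg, neg_mem_lattice_iff]; exact h.two_lam
  x_add := by rw [← sub_eq_add_neg]; exact h.x_sub
  x_sub := by rw [sub_neg_eq_add]; exact h.x_add
  xt_add := by rw [← sub_eq_add_neg]; exact h.xt_sub
  xt_sub := by rw [sub_neg_eq_add]; exact h.xt_add
  x1_add := by rw [← sub_eq_add_neg]; exact h.x1_sub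
  x1_sub := by rw [sub_neg_eq_add]; exact h.x1_add
  x_eps := by rw [← sub_eq_add_neg, sub_neg_eq_add]; exact h.x_eps'
  x_eps' := by rw [← sub_eq_add_neg, sub_neg_eq_add]; exact h.x_eps
  x_beta := by rw [← sub_eq_add_neg, sub_neg_eq_add]; exact h.x_beta'
  x_beta' := by rw [← sub_eq_add_neg, sub_neg_eq_add]; exact h.x_beta
  xt_beta := by rw [← sub_eq_add_neg, sub_neg_eq_add]; exact h.xt_beta'
  xt_beta' := by rw [← sub_eq_add_neg, sub_neg_eq_add]; exact h.xt_beta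
  x1_eps := by rw [← sub_eq_add_neg, sub_neg_eq_add]; exact h.x1_eps'
  x1_eps' := by rw [← sub_eq_add_neg, sub_neg_eq_add]; exact h.x1_eps

lemma CellAdmissible.neg_tilde {x xt x1 β ε lam : ℂ} (h : CellAdmissible Ω x xt x1 β ε lam) :
    CellAdmissible Ω x (-xt) x1 β ε lam :=
  { h with
    two_xt := by rw [mul_neg, neg_mem_lattice_iff]; exact h.two_xt
    xt_add := by rw [← neg_mem_lattice_iff]; convert h.xt_sub using 2; ring
    xt_sub := by rw [← neg_mem_lattice_iff]; convert h.xt_add using 2; ring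
    xt_beta := by rw [← neg_mem_lattice_iff]; convert h.xt_beta' using 2; ring
    xt_beta' := by rw [← neg_mem_lattice_iff]; convert h.xt_beta using 2; ring }

/-- Only one of the two terms of `L̃ V ψ(x+λ)` contributes, as the other one is a multiple of
`ψ(x̃+λ-β)`. -/
lemma wedge_matL_mul_matV {x xt x1 β ε lam : ℂ} (h : CellAdmissible Ω x xt x1 β ε lam) (pt g : ℂ) :
    wedge (psi Ω (xt + lam - β))
        ((matL Ω xt pt β lam * matV Ω x g ε lam).mulVec (psi Ω (x + lam))) =
      exp g * (exp pt)⁻¹ * sigma Ω (x - xt - ε) *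
        (sigma Ω (x + xt + 2 * lam - ε) * sigma Ω (2 * lam - 2 * β) / sigma Ω (2 * lam)) := by
  rw [← Matrix.mulVec_mulVec, matV_eq_matL, matL_mulVec_psi Ω _ _ h.two_x h.two_lam h.x_add h.x_sub,
    Matrix.mulVec_smul, wedge_smul_right, matL_mulVec, wedge_sub_right, wedge_smul_right,
    wedge_smul_right, wedge_self, wedge_psi Ω h.xt_add h.x_eps, wedge_psi Ω h.xt_beta h.xt_beta',
    exp_neg]
  have e1 : xt + lam + (x + lam - ε) = x + xt + 2 * lam - ε := by ring
  have e2 : xt + lam - (x + lam - ε) = -(x - xt - ε) := by ring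
  have e3 : xt + lam - β + (xt - lam + β) = 2 * xt := by ring
  have e4 : xt + lam - β - (xt - lam + β) = 2 * lam - 2 * β := by ring
  have h1 := sigma_ne_zero Ω h.two_xt
  have h2 := sigma_ne_zero Ω h.two_lam
  have h3 := exp_ne_zero pt
  rw [e1, e2, e3, e4, sigma_neg]
  field

/-- The two terms of `V₁ L ψ(x+λ)` combine by the identity `sigma_four_product`, with `X = x₁`. -/
lemma wedge_matV_mul_matL {x xt x1 β ε lam : ℂ} (h : CellAdmissible Ω x xt x1 β ε lam) (p : ℂ)
    {g1 : ℂ} (hg : EpsGRel Ω x xt x1 β ε (exp g1)) :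
    sigma Ω (x1 + x + β) * sigma Ω (x1 - xt - (β - ε)) *
      wedge (psi Ω (xt + lam - β))
        ((matV Ω x1 g1 ε lam * matL Ω x p β lam).mulVec (psi Ω (x + lam))) =
      exp p * exp g1 *
        (sigma Ω (x - xt + ε) * sigma Ω (x1 + x - β) * sigma Ω (x1 - xt + (β - ε))) *
        (sigma Ω (x + xt + 2 * lam - ε) * sigma Ω (2 * lam - 2 * β) / sigma Ω (2 * lam)) := by
  rw [← Matrix.mulVec_mulVec, matV_eq_matL, matL_mulVec_psi Ω _ _ h.two_x h.two_lam h.x_add h.x_sub,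
    Matrix.mulVec_smul, wedge_smul_right, matL_mulVec, wedge_sub_right, wedge_smul_right,
    wedge_smul_right, wedge_psi Ω h.x1_sub h.x_beta, wedge_psi Ω h.x1_add h.x_beta,
    wedge_psi Ω h.xt_beta h.x1_eps, wedge_psi Ω h.xt_beta h.x1_eps', exp_neg]
  have key := sigma_four_product Ω x1 (x + β) (-xt - (β - ε)) (xt + 2 * lam - β - ε)
    (-x - 2 * lam + β) (by ring)
  have a1 : x1 + (x + β) = x1 + x + β := by ring
  have a2 : x1 + (-xt - (β - ε)) = x1 - xt - (β - ε) := by ring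
  have b1 : x1 - (x + β) = x1 - x - β := by ring
  have b2 : x1 - (-xt - (β - ε)) = x1 + xt + (β - ε) := by ring
  have s1 : x + β + (-xt - (β - ε)) = x - xt + ε := by ring
  have s2 : x + β + (xt + 2 * lam - β - ε) = x + xt + 2 * lam - ε := by ring
  have s3 : x + β + (-x - 2 * lam + β) = -(2 * lam - 2 * β) := by ring
  have e1 : x1 - lam + (x + lam - β) = x1 + x - β := by ring
  have e2 : x1 - lam - (x + lam - β) = x1 + (-x - 2 * lam + β) := by ring
  have e3 : xt + lam - β + (x1 + lam - ε) = x1 + (xt + 2 * lam - β - ε) := by ring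
  have e4 : xt + lam - β - (x1 + lam - ε) = -(x1 - xt + (β - ε)) := by ring
  have e5 : x1 + lam + (x + lam - β) = x1 - (-x - 2 * lam + β) := by ring
  have e6 : x1 + lam - (x + lam - β) = x1 - x + β := by ring
  have e7 : xt + lam - β + (x1 - lam + ε) = x1 + xt - (β - ε) := by ring
  have e8 : xt + lam - β - (x1 - lam + ε) = -(x1 - (xt + 2 * lam - β - ε)) := by ring
  rw [a1, a2, b1, b2, s1, s2, s3, sigma_neg] at key
  rw [e1, e2, e3, e4, e5, e6, e7, e8, sigma_neg, sigma_neg]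
  rw [EpsGRel] at hg
  have h1 := sigma_ne_zero Ω h.two_x1
  have h2 := sigma_ne_zero Ω h.two_lam
  have h3 := exp_ne_zero g1
  generalize sigma Ω (x1 + (xt + 2 * lam - β - ε)) = A at *
  generalize sigma Ω (x1 - (xt + 2 * lam - β - ε)) = A' at *
  generalize sigma Ω (x1 + (-x - 2 * lam + β)) = B at *
  generalize sigma Ω (x1 - (-x - 2 * lam + β)) = B' at *
  generalize sigma Ω (x1 + x + β) = q1 at *
  generalize sigma Ω (x1 - xt - (β - ε)) = q2 at *
  generalize sigma Ω (x1 - x - β) = r1 at *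
  generalize sigma Ω (x1 + xt + (β - ε)) = r2 at *
  generalize sigma Ω (x1 + x - β) = u1 at *
  generalize sigma Ω (x1 - xt + (β - ε)) = u2 at *
  generalize sigma Ω (2 * x1) = d1 at *
  generalize sigma Ω (2 * lam) = d2 at *
  generalize sigma Ω (2 * lam - 2 * β) = d3 at *
  generalize sigma Ω (x + xt + 2 * lam - ε) = d4 at *
  generalize exp g1 = G at *
  field_simp
  linear_combination -B' * A' * hg - G ^ 2 * u1 * u2 * key

end

/-! ### The zero curvature equation at one site -/

section

variable {Ω : PeriodPair}

lemma cellRel_of_matrix_eq {x xt x1 β ε lam p pt g g1 c : ℂ}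
    (h : CellAdmissible Ω x xt x1 β ε lam) (hg : EpsGRel Ω x xt x1 β ε (exp g1))
    (h1 : x + xt + 2 * lam - ε ∉ Ω.lattice) (h2 : 2 * lam - 2 * β ∉ Ω.lattice)
    (heq : matL Ω xt pt β lam * matV Ω x g ε lam =
      c • (matV Ω x1 g1 ε lam * matL Ω x p β lam)) :
    CellRel Ω x xt x1 β ε (exp p) (exp pt) (exp g) (exp g1) c := by
  have hA := wedge_matL_mul_matV h pt g
  have hB := wedge_matV_mul_matL h p hg
  rw [heq, Matrix.smul_mulVec, wedge_smul_right] at hA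
  have hR := div_ne_zero (mul_ne_zero (sigma_ne_zero Ω h1) (sigma_ne_zero Ω h2))
    (sigma_ne_zero Ω h.two_lam)
  have hT := exp_ne_zero pt
  rw [CellRel]
  refine mul_right_cancel₀ hR ?_
  have hT' : exp pt * (exp pt)⁻¹ = 1 := mul_inv_cancel₀ hT
  linear_combination c * exp pt * hB -
    sigma Ω (x1 + x + β) * sigma Ω (x1 - xt - (β - ε)) * exp pt * hA -
    exp g * (sigma Ω (x - xt - ε) * sigma Ω (x1 + x + β) * sigma Ω (x1 - xt - (β - ε))) *
      (sigma Ω (x + xt + 2 * lam - ε) * sigma Ω (2 * lam - 2 * β) / sigma Ω (2 * lam)) * hT'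

lemma wedge_eq_of_cellRel {x xt x1 β ε lam p pt g g1 c : ℂ}
    (h : CellAdmissible Ω x xt x1 β ε lam) (hg : EpsGRel Ω x xt x1 β ε (exp g1))
    (h1 : x1 + x + β ∉ Ω.lattice) (h2 : x1 - xt - (β - ε) ∉ Ω.lattice)
    (hrel : CellRel Ω x xt x1 β ε (exp p) (exp pt) (exp g) (exp g1) c) :
    wedge (psi Ω (xt + lam - β))
        ((matL Ω xt pt β lam * matV Ω x g ε lam).mulVec (psi Ω (x + lam))) =
      wedge (psi Ω (xt + lam - β))
        ((c • (matV Ω x1 g1 ε lam * matL Ω x p β lam)).mulVec (psi Ω (x + lam))) := by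
  have hB := wedge_matV_mul_matL h p hg
  rw [wedge_matL_mul_matV h, Matrix.smul_mulVec, wedge_smul_right]
  refine mul_left_cancel₀ (mul_ne_zero (sigma_ne_zero Ω h1) (sigma_ne_zero Ω h2)) ?_
  have hT' : exp pt * (exp pt)⁻¹ = 1 := mul_inv_cancel₀ (exp_ne_zero pt)
  rw [CellRel] at hrel
  generalize sigma Ω (x + xt + 2 * lam - ε) * sigma Ω (2 * lam - 2 * β) / sigma Ω (2 * lam) = R at *
  linear_combination (exp pt)⁻¹ * R * hrel - c * hB + c * exp p * exp g1 * R *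
    (sigma Ω (x - xt + ε) * sigma Ω (x1 + x - β) * sigma Ω (x1 - xt + (β - ε))) * hT'

/-- Two vectors agree if their determinants with the independent vectors `ψ(x̃+λ-β)` and
`ψ(x̃-λ+β)` agree. -/
lemma mulVec_psi_eq_of_cellRel {x xt x1 β ε lam p pt g g1 c : ℂ}
    (h : CellAdmissible Ω x xt x1 β ε lam) (hg : EpsGRel Ω x xt x1 β ε (exp g1))
    (hl : 2 * lam - 2 * β ∉ Ω.lattice) (h1 : x1 + x + β ∉ Ω.lattice)
    (h2 : x1 - xt - (β - ε) ∉ Ω.lattice) (h3 : x1 + xt - (β - ε) ∉ Ω.lattice)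
    (hrel : CellRel Ω x xt x1 β ε (exp p) (exp pt) (exp g) (exp g1) c)
    (hrel' : CellRel Ω x (-xt) x1 β ε (exp p) (exp (-pt)) (exp g) (exp g1) c) :
    (matL Ω xt pt β lam * matV Ω x g ε lam).mulVec (psi Ω (x + lam)) =
      (c • (matV Ω x1 g1 ε lam * matL Ω x p β lam)).mulVec (psi Ω (x + lam)) := by
  have hA := wedge_eq_of_cellRel h hg h1 h2 hrel
  have hB := wedge_eq_of_cellRel h.neg_tilde hg.neg_tilde h1 (by rwa [sub_neg_eq_add]) hrel'
  rw [matL_neg_left] at hB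
  refine eq_of_wedge_eq ?_ hA hB
  have e1 : -xt + lam - β = -(xt - lam + β) := by ring
  have e2 : xt + lam - β + (xt - lam + β) = 2 * xt := by ring
  have e3 : xt + lam - β - (xt - lam + β) = 2 * lam - 2 * β := by ring
  rw [e1, psi_neg, wedge_psi Ω h.xt_beta h.xt_beta', e2, e3]
  exact neg_ne_zero.mpr (mul_ne_zero (sigma_ne_zero Ω h.two_xt) (sigma_ne_zero Ω hl))

variable (Ω) in
/-- The edges of the cell which enter the local zero curvature equation are nondegenerate. -/
structure CellGeneric (x xt x1 β ε : ℂ) : Prop where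
  two_x : 2 * x ∉ Ω.lattice
  two_xt : 2 * xt ∉ Ω.lattice
  two_x1 : 2 * x1 ∉ Ω.lattice
  vert : LegDefined Ω x xt ε
  horiz : LegDefined Ω x x1 β
  diag : LegDefined Ω xt x1 (β - ε)

/-- The matrices agree on `ψ(x+λ)`, and on `ψ(x-λ)` by the same computation with all signs except
those of the fields reversed. -/
lemma matrix_eq_of_cellRel {x xt x1 β ε lam p pt g g1 c : ℂ} (hx : CellGeneric Ω x xt x1 β ε)
    (h : CellAdmissible Ω x xt x1 β ε lam) (hg : EpsGRel Ω x xt x1 β ε (exp g1))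
    (hl : 2 * lam - 2 * β ∉ Ω.lattice) (hc : c = 1 ∨ c = -1)
    (hrel : CellRel Ω x xt x1 β ε (exp p) (exp pt) (exp g) (exp g1) c)
    (hrel' : CellRel Ω x (-xt) x1 β ε (exp p) (exp (-pt)) (exp g) (exp g1) c) :
    matL Ω xt pt β lam * matV Ω x g ε lam =
      c • (matV Ω x1 g1 ε lam * matL Ω x p β lam) := by
  obtain ⟨ha1, ha2, ha3, ha4⟩ := hx.horiz
  obtain ⟨hb1, hb2, hb3, hb4⟩ := hx.diag
  have c1 : x1 + x + β ∉ Ω.lattice := by rwa [add_comm x1]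
  have c2 : x1 - xt - (β - ε) ∉ Ω.lattice := by
    rw [← neg_mem_lattice_iff]; convert hb2 using 2; ring
  have c3 : x1 + xt - (β - ε) ∉ Ω.lattice := by rwa [add_comm x1]
  have c4 : x1 + x + -β ∉ Ω.lattice := by rwa [add_comm x1, ← sub_eq_add_neg]
  have c5 : x1 - xt - (-β - -ε) ∉ Ω.lattice := by
    rw [← neg_mem_lattice_iff]; convert hb4 using 2; ring
  have c6 : x1 + xt - (-β - -ε) ∉ Ω.lattice := by convert hb1 using 2; ring
  have e := exp_ne_zero
  have hA := mulVec_psi_eq_of_cellRel h hg hl c1 c2 c3 hrel hrel'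
  have hB := mulVec_psi_eq_of_cellRel (p := -p) (pt := -pt) (g := -g) (g1 := -g1) h.neg
    (by rw [exp_neg]; exact hg.neg (e _))
    (by rw [← neg_mem_lattice_iff]; convert hl using 2; ring) c4 c5 c6
    (by simpa only [exp_neg] using hrel.neg (e _) (e _) (e _) (e _) hc)
    (by
      rw [exp_neg p, exp_neg (-pt), exp_neg g, exp_neg g1]
      exact hrel'.neg (e _) (e _) (e _) (e _) hc)
  simp only [matV_eq_matL, matL_neg_neg] at hA hB ⊢
  refine matrix_eq_of_mulVec_eq ?_ hA hB
  have e1 : x + lam + (x + -lam) = 2 * x := by ring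
  have e2 : x + lam - (x + -lam) = 2 * lam := by ring
  rw [wedge_psi Ω h.x_add (by rw [← sub_eq_add_neg]; exact h.x_sub), e1, e2]
  exact neg_ne_zero.mpr (mul_ne_zero (sigma_ne_zero Ω h.two_x) (sigma_ne_zero Ω h.two_lam))

/-- Affine functions of the spectral parameter avoid the lattice in a punctured neighbourhood of
each point. -/
lemma eventually_mul_add_notMem_lattice {a : ℂ} (ha : a ≠ 0) (b z : ℂ) :
    ∀ᶠ w in 𝓝[≠] z, a * w + b ∉ Ω.lattice := by
  have hc : ContinuousAt (fun w ↦ a * w + b) z := by fun_prop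
  filter_upwards [self_mem_nhdsWithin, mem_nhdsWithin_of_mem_nhds
    (hc.preimage_mem_nhds (Ω.compl_lattice_sdiff_singleton_mem_nhds (a * z + b)))] with w hw hw' hmem
  refine hw' ⟨hmem, fun h ↦ hw ?_⟩
  exact mul_left_cancel₀ ha (add_right_cancel h)

lemma eventually_cellAdmissible {x xt x1 : ℂ} (β ε : ℂ) (hx : 2 * x ∉ Ω.lattice)
    (hxt : 2 * xt ∉ Ω.lattice) (hx1 : 2 * x1 ∉ Ω.lattice) (z : ℂ) :
    ∀ᶠ lam in 𝓝[≠] z, CellAdmissible Ω x xt x1 β ε lam := by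
  have h1 (b : ℂ) := eventually_mul_add_notMem_lattice (Ω := Ω) one_ne_zero b z
  have h2 := eventually_mul_add_notMem_lattice (Ω := Ω) two_ne_zero 0 z
  have h3 (b : ℂ) := eventually_mul_add_notMem_lattice (Ω := Ω) (neg_ne_zero.mpr one_ne_zero) b z
  filter_upwards [h2, h1 x, h3 x, h1 xt, h3 xt, h1 x1, h3 x1, h1 (x - ε), h3 (x + ε), h1 (x - β),
    h3 (x + β), h1 (xt - β), h3 (xt + β), h1 (x1 - ε), h3 (x1 + ε)] with
    lam k1 k2 k3 k4 k5 k6 k7 k8 k9 k10 k11 k12 k13 k14 k15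
  constructor
  · exact hx
  · exact hxt
  · exact hx1
  · convert k1 using 2; ring
  · convert k2 using 2; ring
  · convert k3 using 2; ring
  · convert k4 using 2; ring
  · convert k5 using 2; ring
  · convert k6 using 2; ring
  · convert k7 using 2; ring
  · convert k8 using 2; ring
  · convert k9 using 2; ring
  · convert k10 using 2; ring
  · convert k11 using 2; ring
  · convert k12 using 2; ring
  · convert k13 using 2; ring
  · convert k14 using 2; ring
  · convert k15 using 2; ring

lemma continuousAt_matM {x β lam : ℂ} (h2x : 2 * x ∉ Ω.lattice) (h2l : 2 * lam ∉ Ω.lattice)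
    (h1 : x + lam - β ∉ Ω.lattice) (h2 : x - lam ∉ Ω.lattice) :
    ContinuousAt (matM Ω x β) lam := by
  have c1 : ContinuousAt (fun lam ↦ Ω.weierstrassP (x + lam - β)) lam :=
    ContinuousAt.comp (f := fun lam ↦ x + lam - β)
      (Ω.analyticOnNhd_weierstrassP _ h1).continuousAt (by fun_prop)
  have c2 : ContinuousAt (fun lam ↦ Ω.weierstrassP (x - lam)) lam :=
    ContinuousAt.comp (f := fun lam ↦ x - lam)
      (Ω.analyticOnNhd_weierstrassP _ h2).continuousAt (by fun_prop)
  have h3 := mul_ne_zero (sigma_ne_zero Ω h2x) (sigma_ne_zero Ω h2l)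
  have c3 : ContinuousAt (fun lam ↦ sigma Ω (x + lam - β) ^ 2 * sigma Ω (x - lam) ^ 2 /
      (sigma Ω (2 * x) * sigma Ω (2 * lam))) lam := by
    refine ContinuousAt.div ?_ ?_ h3 <;> exact Continuous.continuousAt (by fun_prop)
  have c4 : ContinuousAt (fun lam ↦ (!![-Ω.weierstrassP (x + lam - β),
      Ω.weierstrassP (x + lam - β) * Ω.weierstrassP (x - lam);
      -1, Ω.weierstrassP (x - lam)] : Matrix (Fin 2) (Fin 2) ℂ)) lam := by
    refine continuousAt_pi.mpr fun i ↦ continuousAt_pi.mpr fun j ↦ ?_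
    fin_cases i <;> fin_cases j
    · exact c1.neg
    · exact c1.mul c2
    · exact continuousAt_const
    · exact c2
  exact c3.smul c4

lemma continuousAt_matL {x β lam : ℂ} (p : ℂ) (h2x : 2 * x ∉ Ω.lattice) (h2l : 2 * lam ∉ Ω.lattice)
    (h1 : x + lam - β ∉ Ω.lattice) (h2 : x - lam ∉ Ω.lattice) (h3 : x - lam + β ∉ Ω.lattice)
    (h4 : x + lam ∉ Ω.lattice) : ContinuousAt (matL Ω x p β) lam := by
  have c1 := continuousAt_matM h2x h2l h1 h2
  have c2 : ContinuousAt (matM Ω x (-β)) (-lam) := continuousAt_matM h2x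
    (by rwa [mul_neg, neg_mem_lattice_iff]) (by rwa [← sub_eq_add_neg, sub_neg_eq_add])
    (by rwa [sub_neg_eq_add])
  have c3 : ContinuousAt (fun lam ↦ matM Ω x (-β) (-lam)) lam :=
    c2.comp (f := fun lam ↦ -lam) continuousAt_neg
  exact (c1.const_smul (exp p)).add (c3.const_smul (exp (-p)))

/-- The zero curvature equation at one site is equivalent to two relations without spectral
parameter. The second one is the first with `x̃, p̃` replaced by `-x̃, -p̃`. -/
theorem forall_matrix_eq_iff_cellRel {x xt x1 β ε p pt g g1 c : ℂ}
    (hx : CellGeneric Ω x xt x1 β ε) (hg : EpsGRel Ω x xt x1 β ε (exp g1)) (hc : c = 1 ∨ c = -1) :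
    (∀ lam, CellAdmissible Ω x xt x1 β ε lam → matL Ω xt pt β lam * matV Ω x g ε lam =
        c • (matV Ω x1 g1 ε lam * matL Ω x p β lam)) ↔
      CellRel Ω x xt x1 β ε (exp p) (exp pt) (exp g) (exp g1) c ∧
        CellRel Ω x (-xt) x1 β ε (exp p) (exp (-pt)) (exp g) (exp g1) c := by
  have hadm := eventually_cellAdmissible β ε hx.two_x hx.two_xt hx.two_x1
  have hev (b z : ℂ) := eventually_mul_add_notMem_lattice (Ω := Ω) two_ne_zero b z
  constructor
  · intro h
    obtain ⟨lam, ha, h1, h2, h3⟩ := ((hadm 0).and ((hev (x + xt - ε) 0).and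
      ((hev (x - xt - ε) 0).and (hev (-(2 * β)) 0)))).exists
    have h4 : 2 * lam - 2 * β ∉ Ω.lattice := by rwa [sub_eq_add_neg]
    refine ⟨cellRel_of_matrix_eq ha hg (by convert h1 using 2; ring) h4 (h lam ha),
      cellRel_of_matrix_eq (lam := lam) ha.neg_tilde hg.neg_tilde (by convert h2 using 2; ring) h4 ?_⟩
    rw [matL_neg_left]
    exact h lam ha
  · rintro ⟨h1, h2⟩ lam ha
    -- The relations give the equation where `2λ - 2β` is not a period; the remaining spectral
    -- parameters are limits of such.
    have hV : ContinuousAt (matV Ω x g ε) lam := continuousAt_matL g ha.two_x ha.two_lam ha.x_eps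
      ha.x_sub ha.x_eps' ha.x_add
    have hV1 : ContinuousAt (matV Ω x1 g1 ε) lam := continuousAt_matL g1 ha.two_x1 ha.two_lam
      ha.x1_eps ha.x1_sub ha.x1_eps' ha.x1_add
    have hL := continuousAt_matL p ha.two_x ha.two_lam ha.x_beta ha.x_sub ha.x_beta' ha.x_add
    have hLt := continuousAt_matL pt ha.two_xt ha.two_lam ha.xt_beta ha.xt_sub ha.xt_beta' ha.xt_add
    refine tendsto_nhds_unique_of_eventuallyEq (l := 𝓝[≠] lam)
      ((hLt.mul hV).tendsto.mono_left nhdsWithin_le_nhds)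
      (((hV1.mul hL).const_smul c).tendsto.mono_left nhdsWithin_le_nhds) ?_
    filter_upwards [hadm lam, hev (-(2 * β)) lam] with w hw hw'
    exact matrix_eq_of_cellRel hx hw hg (by rwa [sub_eq_add_neg]) hc h1 h2

end

/-! ### Values of half logarithms and the equations of motion -/

section

variable {Ω : PeriodPair}

lemma legDefined_comm {x y α : ℂ} (h : LegDefined Ω x y α) : LegDefined Ω y x α := by
  obtain ⟨h1, h2, h3, h4⟩ := h
  refine ⟨by rwa [add_comm y], ?_, by rwa [add_comm y], ?_⟩ <;> rw [← neg_mem_lattice_iff]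
  · convert h4 using 2; ring
  · convert h2 using 2; ring

lemma legF_ne_zero {x y α : ℂ} (h : LegDefined Ω x y α) : legF Ω x y α ≠ 0 :=
  div_ne_zero (mul_ne_zero (sigma_ne_zero Ω h.1) (sigma_ne_zero Ω h.2.1))
    (mul_ne_zero (sigma_ne_zero Ω h.2.2.1) (sigma_ne_zero Ω h.2.2.2))

/-- `F(x, y; α)` with the difference of the arguments reversed. -/
lemma legF_swap (x y α : ℂ) : legF Ω x y α =
    sigma Ω (y + x + α) * sigma Ω (y - x - α) / (sigma Ω (y + x - α) * sigma Ω (y - x + α)) := by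
  have e1 : x - y + α = -(y - x - α) := by ring
  have e2 : x - y - α = -(y - x + α) := by ring
  rw [legF, e1, e2, sigma_neg, sigma_neg, add_comm x, mul_neg, mul_neg, neg_div_neg_eq]

/-- The relation for `g₁` says that `g₁` is a value of `εG` at the next site. -/
lemma epsGRel_iff {x xt x1 β ε G1 : ℂ} (hx : CellGeneric Ω x xt x1 β ε) :
    EpsGRel Ω x xt x1 β ε G1 ↔ G1 ^ 2 = legF Ω x1 x β / legF Ω x1 xt (β - ε) := by
  obtain ⟨ha1, ha2, ha3, ha4⟩ := legDefined_comm hx.horiz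
  obtain ⟨hb1, hb2, hb3, hb4⟩ := legDefined_comm hx.diag
  have hne := mul_ne_zero (mul_ne_zero (sigma_ne_zero Ω ha3) (sigma_ne_zero Ω ha4))
    (mul_ne_zero (sigma_ne_zero Ω hb1) (sigma_ne_zero Ω hb2))
  rw [EpsGRel, legF, legF, div_div_div_eq, eq_div_iff hne]

/-- Two equations with a common unknown sign are equivalent to the equations for their quotient and
their product, which do not contain the sign. -/
lemma exists_sign_iff {E T G G1 a₁ b₁ a₂ b₂ : ℂ} (hE : E ≠ 0) (hT : T ≠ 0) (hG : G ≠ 0)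
    (hG1 : G1 ≠ 0) (ha₁ : a₁ ≠ 0) (hb₁ : b₁ ≠ 0) (ha₂ : a₂ ≠ 0) (hb₂ : b₂ ≠ 0) :
    (∃ c : ℂ, (c = 1 ∨ c = -1) ∧ G * a₁ = c * (E * T * G1) * b₁ ∧
        G * a₂ = c * (E * T⁻¹ * G1) * b₂) ↔
      T ^ 2 * (b₁ * a₂) = a₁ * b₂ ∧ G ^ 2 * (a₁ * a₂) = E ^ 2 * G1 ^ 2 * (b₁ * b₂) := by
  constructor
  · rintro ⟨c, hc, h1, h2⟩
    have hc2 : c ^ 2 = 1 := by rcases hc with rfl | rfl <;> norm_num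
    have hc0 : c ≠ 0 := by rintro rfl; norm_num at hc
    field_simp at h2
    constructor
    · refine mul_left_cancel₀ (mul_ne_zero (mul_ne_zero hG hc0) (mul_ne_zero hE hG1)) ?_
      linear_combination T * c * E * G1 * b₁ * h2 - c * E * G1 * b₂ * h1
    · refine mul_left_cancel₀ hT ?_
      linear_combination G * T * a₂ * h1 + c * (E * T * G1) * b₁ * h2 +
        E ^ 2 * T * G1 ^ 2 * b₁ * b₂ * hc2
  · rintro ⟨h1, h2⟩
    refine ⟨G * a₁ / (E * T * G1 * b₁), mul_self_eq_one_iff.mp ?_, by field, ?_⟩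
    · rw [div_mul_div_comm, div_eq_one_iff_eq (by positivity)]
      refine mul_right_cancel₀ (mul_ne_zero ha₂ hb₂) ?_
      linear_combination a₁ * b₂ * h2 - E ^ 2 * G1 ^ 2 * b₁ * b₂ * h1
    · field_simp
      linear_combination h1

/-- The two relations hold with some sign if and only if the equations of motion hold for the squares
of `e^p̃` and `e^p`. -/
theorem exists_cellRel_iff {x xt x1 β ε E T G G1 : ℂ} (hx : CellGeneric Ω x xt x1 β ε)
    (hE : E ≠ 0) (hT : T ≠ 0) (hG : G ≠ 0) (hG1 : G1 ≠ 0) (hg : EpsGRel Ω x xt x1 β ε G1) :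
    (∃ c : ℂ, (c = 1 ∨ c = -1) ∧ CellRel Ω x xt x1 β ε E T G G1 c ∧
        CellRel Ω x (-xt) x1 β ε E T⁻¹ G G1 c) ↔
      T ^ 2 = legF Ω xt x ε * legF Ω xt x1 (β - ε) ∧
        E ^ 2 = G ^ 2 * (legF Ω x x1 β / legF Ω x xt ε) := by
  obtain ⟨hv1, hv2, hv3, hv4⟩ := hx.vert
  obtain ⟨ha1, ha2, ha3, ha4⟩ := legDefined_comm hx.horiz
  obtain ⟨hb1, hb2, hb3, hb4⟩ := legDefined_comm hx.diag
  simp only [CellRel, sub_neg_eq_add]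
  rw [EpsGRel] at hg
  rw [legF_swap xt x, legF_swap xt x1, legF_swap x x1, legF]
  have n1 := sigma_ne_zero Ω hv1
  have n2 := sigma_ne_zero Ω hv2
  have n3 := sigma_ne_zero Ω hv3
  have n4 := sigma_ne_zero Ω hv4
  have n5 := sigma_ne_zero Ω ha1
  have n6 := sigma_ne_zero Ω ha2
  have n7 := sigma_ne_zero Ω ha3
  have n8 := sigma_ne_zero Ω ha4
  have n9 := sigma_ne_zero Ω hb1
  have n10 := sigma_ne_zero Ω hb2
  have n11 := sigma_ne_zero Ω hb3
  have n12 := sigma_ne_zero Ω hb4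
  generalize sigma Ω (x + xt + ε) = v1 at *
  generalize sigma Ω (x - xt + ε) = v2 at *
  generalize sigma Ω (x + xt - ε) = v3 at *
  generalize sigma Ω (x - xt - ε) = v4 at *
  generalize sigma Ω (x1 + x + β) = a1 at *
  generalize sigma Ω (x1 - x + β) = a2 at *
  generalize sigma Ω (x1 + x - β) = a3 at *
  generalize sigma Ω (x1 - x - β) = a4 at *
  generalize sigma Ω (x1 + xt + (β - ε)) = b1 at *
  generalize sigma Ω (x1 - xt + (β - ε)) = b2 at *
  generalize sigma Ω (x1 + xt - (β - ε)) = b3 at *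
  generalize sigma Ω (x1 - xt - (β - ε)) = b4 at *
  rw [exists_sign_iff hE hT hG hG1 (by positivity) (by positivity) (by positivity) (by positivity)]
  refine and_congr ?_ ?_
  · rw [div_mul_div_comm, eq_div_iff (by positivity)]
    constructor <;> intro h
    · refine mul_left_cancel₀ (mul_ne_zero n5 n7) ?_
      linear_combination h
    · linear_combination a1 * a3 * h
  · rw [div_div_div_eq, mul_div_assoc', eq_div_iff (by positivity)]
    constructor <;> intro h
    · refine mul_left_cancel₀ (mul_ne_zero (mul_ne_zero n5 n11) n12) ?_
      linear_combination -a4 * h - E ^ 2 * v1 * v2 * a3 * hg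
    · refine mul_left_cancel₀ n8 ?_
      linear_combination -a1 * b3 * b4 * h - E ^ 2 * v1 * v2 * a3 * hg

/-- All halves of logarithms of `a`, modulo `πi`. -/
def halfLog (a : ℂ) : Set ℂ := {w | exp (2 * w) = a}

lemma legf_eq_halfLog (x y α : ℂ) : legf Ω x y α = halfLog (legF Ω x y α) := rfl

lemma halfLog_nonempty {a : ℂ} (ha : a ≠ 0) : (halfLog a).Nonempty :=
  ⟨log a / 2, by
    change exp (2 * (log a / 2)) = a
    rw [mul_div_cancel₀ _ two_ne_zero, exp_log ha]⟩

lemma neg_halfLog (a : ℂ) : -halfLog a = halfLog a⁻¹ := by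
  ext w
  simp only [halfLog, Set.mem_neg, Set.mem_ofPred_eq, mul_neg, exp_neg, inv_eq_iff_eq_inv]

lemma halfLog_add_halfLog {a : ℂ} (b : ℂ) (ha : a ≠ 0) :
    halfLog a + halfLog b = halfLog (a * b) := by
  ext w
  constructor
  · rintro ⟨u, hu, v, hv, rfl⟩
    change exp (2 * (u + v)) = a * b
    rw [mul_add, exp_add, hu, hv]
  · intro hw
    obtain ⟨u, hu⟩ := halfLog_nonempty ha
    refine ⟨u, hu, w - u, ?_, add_sub_cancel _ _⟩
    change exp (2 * w) = a * b at hw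
    change exp (2 * u) = a at hu
    change exp (2 * (w - u)) = b
    rw [mul_sub, exp_sub, hw, hu, mul_div_cancel_left₀ _ ha]

lemma halfLog_sub_halfLog {a : ℂ} (b : ℂ) (ha : a ≠ 0) :
    halfLog a - halfLog b = halfLog (a / b) := by
  rw [sub_eq_add_neg, neg_halfLog, halfLog_add_halfLog _ ha, div_eq_mul_inv]

lemma mem_halfLog_iff {a w : ℂ} : w ∈ halfLog a ↔ exp w ^ 2 = a := by
  rw [← exp_nat_mul]
  rfl

section Lattice
variable {ε : ℂ} {β x p xt pt g : ℤ → ℂ}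

lemma Generic.cellGeneric (h : Generic Ω ε β x xt) (k : ℤ) :
    CellGeneric Ω (x k) (xt k) (x (k + 1)) (β k) ε :=
  ⟨h.two_x k, h.two_xt k, h.two_x (k + 1), h.vert k, h.horiz k, h.diag k⟩

lemma Generic.horiz_prev (h : Generic Ω ε β x xt) (k : ℤ) :
    LegDefined Ω (x k) (x (k - 1)) (β (k - 1)) := by
  simpa using legDefined_comm (h.horiz (k - 1))

lemma Generic.diag_prev (h : Generic Ω ε β x xt) (k : ℤ) :
    LegDefined Ω (x k) (xt (k - 1)) (β (k - 1) - ε) := by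
  simpa using legDefined_comm (h.diag (k - 1))

lemma Generic.epsG_eq (h : Generic Ω ε β x xt) (k : ℤ) : epsG Ω ε β x xt k =
    halfLog (legF Ω (x k) (x (k - 1)) (β (k - 1)) / legF Ω (x k) (xt (k - 1)) (β (k - 1) - ε)) :=
  halfLog_sub_halfLog _ (legF_ne_zero (h.horiz_prev k))

lemma Generic.epsGRel (h : Generic Ω ε β x xt) (hg : ∀ k, g k ∈ epsG Ω ε β x xt k) (k : ℤ) :
    EpsGRel Ω (x k) (xt k) (x (k + 1)) (β k) ε (exp (g (k + 1))) := by
  have := hg (k + 1)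
  rw [h.epsG_eq, mem_halfLog_iff, add_sub_cancel_right] at this
  exact (epsGRel_iff (h.cellGeneric k)).mpr this

lemma admissible_iff {k : ℤ} {lam : ℂ} :
    Admissible Ω ε β x xt k lam ↔
      CellAdmissible Ω (x k) (xt k) (x (k + 1)) (β k) ε lam := by
  simp only [Admissible, PairDefined, MatDefined, sub_neg_eq_add, ← sub_eq_add_neg, mul_neg,
    neg_mem_lattice_iff]
  constructor
  · rintro ⟨⟨⟨a1, a2, a3, a4⟩, -, -, a5, a6⟩, ⟨⟨b1, -, b3, b4⟩, -, -, b5, b6⟩,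
      ⟨⟨c1, -, c3, c4⟩, -, -, c5, c6⟩, ⟨⟨-, -, d3, -⟩, -, -, d5, -⟩⟩
    constructor <;> assumption
  · intro h
    exact ⟨⟨⟨h.two_xt, h.two_lam, h.xt_beta, h.xt_sub⟩, h.two_xt, h.two_lam, h.xt_beta', h.xt_add⟩,
      ⟨⟨h.two_x, h.two_lam, h.x_eps, h.x_sub⟩, h.two_x, h.two_lam, h.x_eps', h.x_add⟩,
      ⟨⟨h.two_x1, h.two_lam, h.x1_eps, h.x1_sub⟩, h.two_x1, h.two_lam, h.x1_eps', h.x1_add⟩,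
      ⟨⟨h.two_x, h.two_lam, h.x_beta, h.x_sub⟩, h.two_x, h.two_lam, h.x_beta', h.x_add⟩⟩

/-- For a fixed choice of the values of `εG`, zero curvature at `k` up to sign amounts to the
equations of motion at `k`, in exponentiated form. -/
lemma zeroCurvature_or_iff (h : Generic Ω ε β x xt) (hg : ∀ k, g k ∈ epsG Ω ε β x xt k) (k : ℤ) :
    (ZeroCurvature Ω ε β x p xt pt g 1 k ∨ ZeroCurvature Ω ε β x p xt pt g (-1) k) ↔
      exp (pt k) ^ 2 = legF Ω (xt k) (x k) ε * legF Ω (xt k) (x (k + 1)) (β k - ε) ∧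
        exp (p k) ^ 2 = exp (g k) ^ 2 *
          (legF Ω (x k) (x (k + 1)) (β k) / legF Ω (x k) (xt k) ε) := by
  have hc := h.cellGeneric k
  have hG := h.epsGRel hg k
  have e := exp_ne_zero
  rw [← exists_cellRel_iff hc (e _) (e _) (e _) (e _) hG, ← exp_neg]
  have key (c : ℂ) (hc1 : c = 1 ∨ c = -1) :=
    forall_matrix_eq_iff_cellRel (p := p k) (pt := pt k) (g := g k) hc hG hc1
  simp only [ZeroCurvature, admissible_iff]
  rw [key 1 (.inl rfl), key (-1) (.inr rfl)]
  constructor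
  · rintro (h | h)
    exacts [⟨1, .inl rfl, h⟩, ⟨-1, .inr rfl, h⟩]
  · rintro ⟨c, rfl | rfl, h⟩
    exacts [.inl h, .inr h]

lemma isTodaStep_iff (h : Generic Ω ε β x xt) (hg : ∀ k, g k ∈ epsG Ω ε β x xt k) :
    IsTodaStep Ω ε β x p xt pt ↔ ∀ k,
      exp (pt k) ^ 2 = legF Ω (xt k) (x k) ε * legF Ω (xt k) (x (k + 1)) (β k - ε) ∧
        exp (p k) ^ 2 = exp (g k) ^ 2 *
          (legF Ω (x k) (x (k + 1)) (β k) / legF Ω (x k) (xt k) ε) := by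
  have hpt (k) : pt k ∈ legf Ω (xt k) (x k) ε + legf Ω (xt k) (x (k + 1)) (β k - ε) ↔
      exp (pt k) ^ 2 = legF Ω (xt k) (x k) ε * legF Ω (xt k) (x (k + 1)) (β k - ε) := by
    rw [legf_eq_halfLog, legf_eq_halfLog,
      halfLog_add_halfLog _ (legF_ne_zero (legDefined_comm (h.vert k))), mem_halfLog_iff]
  have hp (k) : p k ∈ -legf Ω (x k) (xt k) ε + legf Ω (x k) (x (k + 1)) (β k)
      + legf Ω (x k) (x (k - 1)) (β (k - 1)) - legf Ω (x k) (xt (k - 1)) (β (k - 1) - ε) ↔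
      exp (p k) ^ 2 = exp (g k) ^ 2 *
          (legF Ω (x k) (x (k + 1)) (β k) / legF Ω (x k) (xt k) ε) := by
    have h1 := legF_ne_zero (h.vert k)
    have h2 := legF_ne_zero (h.horiz k)
    have h3 := legF_ne_zero (h.horiz_prev k)
    have hgk := hg k
    rw [h.epsG_eq, mem_halfLog_iff] at hgk
    rw [legf_eq_halfLog, legf_eq_halfLog, legf_eq_halfLog, legf_eq_halfLog, neg_halfLog,
      halfLog_add_halfLog _ (inv_ne_zero h1), halfLog_add_halfLog _ (mul_ne_zero (inv_ne_zero h1) h2),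
      halfLog_sub_halfLog _ (mul_ne_zero (mul_ne_zero (inv_ne_zero h1) h2) h3), mem_halfLog_iff, hgk]
    constructor <;> intro hk <;> rw [hk] <;> ring
  constructor
  · rintro ⟨h1, h2⟩ k
    exact ⟨(hpt k).mp (h2 k), (hp k).mp (h1 k)⟩
  · intro h
    exact ⟨fun k ↦ (hp k).mpr (h k).2, fun k ↦ (hpt k).mpr (h k).1⟩

/-- Signs can be integrated along `ℤ`. -/
lemma exists_sign_potential (s : ℤ → ℤˣ) : ∃ τ : ℤ → ℤˣ, ∀ k, τ (k + 1) = τ k * s k := by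
  refine ⟨fun k ↦ (∏ i ∈ Finset.Ico 0 k, s i) * ∏ i ∈ Finset.Ico k 0, s i, fun k ↦ ?_⟩
  rcases le_or_gt 0 k with hk | hk
  · simp only [Finset.Ico_eq_empty_of_le hk, Finset.Ico_eq_empty_of_le (show 0 ≤ k + 1 by lia)]
    rw [← Finset.insert_Ico_right_eq_Ico_add_one hk, Finset.prod_insert (by simp)]
    simp [mul_comm]
  · simp only [Finset.Ico_eq_empty_of_le hk.le, Finset.Ico_eq_empty_of_le (show k + 1 ≤ 0 by lia)]
    rw [← Finset.insert_Ico_add_one_left_eq_Ico hk, Finset.prod_insert (by simp)]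
    rw [Finset.prod_empty, one_mul, one_mul, mul_right_comm, Int.units_mul_self, one_mul]

/-- A sign in front of `e^w` is realised by a shift of `w` by `0` or `πi`. -/
lemma exists_shift (τ : ℤˣ) (w : ℂ) : ∃ w' : ℂ, exp w' = ((τ : ℤ) : ℂ) * exp w ∧
    exp (-w') = ((τ : ℤ) : ℂ) * exp (-w) := by
  rcases Int.units_eq_one_or τ with rfl | rfl
  · exact ⟨w, by simp⟩
  · refine ⟨w + Real.pi * I, ?_, ?_⟩
    · simp [exp_add]
    · rw [neg_add, exp_add, exp_neg (_ * I), exp_pi_mul_I]; simp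

end Lattice

end

end EllipticToda

open EllipticToda in
theorem mainTheorem2 (Ω : PeriodPair) (ε : ℂ) (β x p xt pt : ℤ → ℂ)
    (hgen : Generic Ω ε β x xt) :
    (IsTodaStep Ω ε β x p xt pt →
      (∃ g : ℤ → ℂ, (∀ k, g k ∈ epsG Ω ε β x xt k) ∧
        ∀ k, ZeroCurvature Ω ε β x p xt pt g 1 k) ∧
      (∀ g : ℤ → ℂ, (∀ k, g k ∈ epsG Ω ε β x xt k) →
        ∀ k, ZeroCurvature Ω ε β x p xt pt g 1 k ∨ ZeroCurvature Ω ε β x p xt pt g (-1) k)) ∧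
    (2 * ε ∉ Ω.lattice → (∀ k, 2 * (β k - ε) ∉ Ω.lattice) →
      ∀ g : ℤ → ℂ, (∀ k, g k ∈ epsG Ω ε β x xt k) →
        (∀ k, ZeroCurvature Ω ε β x p xt pt g 1 k ∨ ZeroCurvature Ω ε β x p xt pt g (-1) k) →
        IsTodaStep Ω ε β x p xt pt) := by
  refine ⟨fun hT ↦ ?_, fun _ _ g hg hZ ↦
    (isTodaStep_iff hgen hg).mpr fun k ↦ (zeroCurvature_or_iff hgen hg k).mp (hZ k)⟩
  have hsign (g : ℤ → ℂ) (hg : ∀ k, g k ∈ epsG Ω ε β x xt k) (k : ℤ) :=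
    (zeroCurvature_or_iff (p := p) (pt := pt) hgen hg k).mpr ((isTodaStep_iff hgen hg).mp hT k)
  refine ⟨?_, hsign⟩
  have hne (k : ℤ) : (epsG Ω ε β x xt k).Nonempty := by
    rw [hgen.epsG_eq]
    exact halfLog_nonempty (div_ne_zero (legF_ne_zero (hgen.horiz_prev k))
      (legF_ne_zero (hgen.diag_prev k)))
  choose g₀ hg₀ using hne
  -- Start from any values of `εG`; the sign at `k` can be absorbed into `V_{k+1}`.
  have hs (k : ℤ) : ∃ s : ℤˣ, ZeroCurvature Ω ε β x p xt pt g₀ ((s : ℤ) : ℂ) k := by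
    rcases hsign g₀ hg₀ k with h | h
    exacts [⟨1, by simpa using h⟩, ⟨-1, by simpa using h⟩]
  choose s hs using hs
  obtain ⟨τ, hτ⟩ := exists_sign_potential s
  choose g hg hg' using fun k ↦ exists_shift (τ k) (g₀ k)
  have hV (k : ℤ) (y lam : ℂ) : matV Ω y (g k) ε lam = ((τ k : ℤ) : ℂ) • matV Ω y (g₀ k) ε lam := by
    rw [matV, matV, hg, hg', smul_add, mul_smul, mul_smul]
  refine ⟨g, fun k ↦ ?_, fun k lam hlam ↦ ?_⟩
  · have h1 := hg₀ k
    rw [hgen.epsG_eq, mem_halfLog_iff] at h1 ⊢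
    rw [← h1, hg, mul_pow]
    rcases Int.units_eq_one_or (τ k) with h | h <;> simp [h]
  · rw [hV, hV, Matrix.mul_smul, hs k lam hlam, smul_smul, Matrix.smul_mul, one_smul, hτ]
    push_cast
    rfl
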